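/- For $x\in\mathbb R$ with regular continued fraction $x=[a_0,a_1,a_2,\dots]$ ($a_0=\lfloor x\rfloor\in\mathbb Z$, $a_i\ge 1$ for $i\ge1$; finite for rational $x$) let $$F(x)=1-2^{-a_0}+2^{-(a_0+a_1)}-2^{-(a_0+a_1+a_2)}+\cdots$$ be the Minkowski question mark function, let $M_L=\int_0^\infty x^L\,dF(x)$ be its moments, and let $c_n=\int_0^1\Psi(x)e^{-2\pi inx}\,dx$ ($n\in\mathbb Z$) be the Fourier coefficients of the $1$-periodic function $\Psi(x)=2^x(1-F(x))$. The dyadic zeta function is defined for $\Re s>0$ by the absolutely convergent series $$\zeta_{\mathcal M}(s)=\sum_{n\in\mathbb Z}\frac{c_n}{(\log 2-2\pi in)^s},$$ where the powers are taken with $\arg(\log 2-2\pi in)\in(-\pi/2,\pi/2)$. Then $\zeta_{\mathcal M}$ extends to an entire function on $\mathbb C$, and this extension has the following properties. (i) $\zeta_{\mathcal M}(s)\Gamma(s)=-\zeta_{\mathcal M}(-s)\Gamma(-s)$, as an identity of meromorphic functions (for all $s\in\mathbb C\setminus\mathbb Z$). (ii) For every integer $L\ge1$ the moment $M_L$ is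 finite and $\zeta_{\mathcal M}(L)=M_L/L!$. (iii) For every integer $L\ge1$, $\zeta_{\mathcal M}(-L)=0$ and $\zeta_{\mathcal M}'(-L)=(-1)^{L-1}(L-1)!\,M_L$. (iv) $\zeta_{\mathcal M}(s)$ is real for real $s$, and $\zeta_{\mathcal M}(\overline s)=\overline{\zeta_{\mathcal M}(s)}$ for all $s\in\mathbb C$. (v) For all real $a\le b$, $$|\zeta_{\mathcal M}(\sigma+it)|\ll|t|^{-\sigma-1/2}e^{\pi|t|/2}$$ uniformly for $a\le\sigma\le b$ as $|t|\to\infty$, with an implied constant depending only on $a$ and $b$. -/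

import Mathlib

namespace Minkowski

open MeasureTheory GenContFract

noncomputable section

/-- The partial quotient `a_k` of the regular continued fraction `x = [a_0, a_1, a_2, ...]` of a
real number (`a_0 = ⌊x⌋` may be negative); `0` past the end of a terminating expansion. -/
def partialQuotient (x : ℝ) (k : ℕ) : ℤ :=
  match IntFractPair.stream x k with
  | none => 0
  | some p => p.b

/-- The `k`-th term `(-1)^(k+1) 2^(-(a_0 + ... + a_k))` of the series for `F([a_0, a_1, ...])`;
it is `0` if the continued fraction has no `k`-th partial quotient. -/
def questionTerm (x : ℝ) (k : ℕ) : ℝ :=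
  match IntFractPair.stream x k with
  | none => 0
  | some _ => (-1) ^ (k + 1) * (2 : ℝ) ^ (-∑ i ∈ Finset.range (k + 1), partialQuotient x i)

/-- The Minkowski question mark function
`F([a_0, a_1, a_2, ...]) = 1 - 2^(-a_0) + 2^(-(a_0+a_1)) - 2^(-(a_0+a_1+a_2)) + ...`,
on the whole real line (`a_0` is allowed to be a negative integer). -/
def F (x : ℝ) : ℝ := 1 + ∑' k, questionTerm x k

/-! The function `F` is monotone; this is what makes the Stieltjes measure `dF` available. -/

theorem questionTerm_zero (x : ℝ) : questionTerm x 0 = -(2 : ℝ) ^ (-⌊x⌋) := by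
  simp [questionTerm, partialQuotient, IntFractPair.stream_zero, IntFractPair.of]

theorem questionTerm_succ_of_fract_eq_zero {x : ℝ} (h : Int.fract x = 0) (k : ℕ) :
    questionTerm x (k + 1) = 0 := by
  have hx : x = ((⌊x⌋ : ℤ) : ℝ) := by
    have := Int.floor_add_fract x
    rw [h, add_zero] at this
    exact this.symm
  rw [hx, questionTerm, IntFractPair.stream_succ_of_int]

theorem questionTerm_succ {x : ℝ} (h : Int.fract x ≠ 0) (k : ℕ) :
    questionTerm x (k + 1) = -(2 : ℝ) ^ (-⌊x⌋) * questionTerm (Int.fract x)⁻¹ k := by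
  have hd : ∀ i, partialQuotient x (i + 1) = partialQuotient (Int.fract x)⁻¹ i := by
    intro i
    rw [partialQuotient, partialQuotient, IntFractPair.stream_succ h]
  have h0 : partialQuotient x 0 = ⌊x⌋ := by
    simp [partialQuotient, IntFractPair.stream_zero, IntFractPair.of]
  rw [questionTerm, questionTerm, IntFractPair.stream_succ h]
  cases IntFractPair.stream (Int.fract x)⁻¹ k with
  | none => simp
  | some p =>
    simp only
    rw [Finset.sum_range_succ', h0]
    simp only [hd]
    rw [neg_add, zpow_add₀ (by norm_num : (2 : ℝ) ≠ 0)]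
    ring

theorem one_le_floor_inv_fract {x : ℝ} (h : Int.fract x ≠ 0) : 1 ≤ ⌊(Int.fract x)⁻¹⌋ := by
  have hp : 0 < Int.fract x := lt_of_le_of_ne (Int.fract_nonneg x) (Ne.symm h)
  rw [Int.le_floor]
  push_cast
  exact (one_le_inv₀ hp).2 (Int.fract_lt_one x).le

theorem two_zpow_neg_le {m n : ℤ} (h : m ≤ n) : (2 : ℝ) ^ (-n) ≤ (2 : ℝ) ^ (-m) :=
  zpow_le_zpow_right₀ (by norm_num) (by omega)

theorem abs_questionTerm_le (k : ℕ) :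
    ∀ x : ℝ, |questionTerm x k| ≤ (2 : ℝ) ^ (-⌊x⌋) * (1 / 2) ^ k := by
  induction k with
  | zero =>
    intro x
    rw [questionTerm_zero, abs_neg, abs_of_pos (by positivity)]
    simp
  | succ k ih =>
    intro x
    by_cases h : Int.fract x = 0
    · rw [questionTerm_succ_of_fract_eq_zero h]
      simp only [abs_zero]
      positivity
    · rw [questionTerm_succ h, abs_mul, abs_neg, abs_of_pos (by positivity : (0 : ℝ) < 2 ^ (-⌊x⌋)),
        pow_succ]
      have h1 := ih (Int.fract x)⁻¹
      have h2 := two_zpow_neg_le (one_le_floor_inv_fract h)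
      have h3 : (2 : ℝ) ^ (-(1 : ℤ)) = 1 / 2 := by norm_num
      rw [h3] at h2
      have h4 : |questionTerm (Int.fract x)⁻¹ k| ≤ (1 / 2) * (1 / 2) ^ k :=
        h1.trans (mul_le_mul_of_nonneg_right h2 (by positivity))
      calc _ ≤ (2 : ℝ) ^ (-⌊x⌋) * ((1 / 2) * (1 / 2) ^ k) :=
            mul_le_mul_of_nonneg_left h4 (by positivity)
        _ = _ := by ring

theorem summable_questionTerm (x : ℝ) : Summable (questionTerm x) := by
  refine Summable.of_norm_bounded (g := fun k => (2 : ℝ) ^ (-⌊x⌋) * (1 / 2) ^ k) ?_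
    (fun k => by simpa using abs_questionTerm_le k x)
  exact (summable_geometric_of_lt_one (by norm_num) (by norm_num)).mul_left _

/-- The partial sums of the series. -/
def questionSum (n : ℕ) (x : ℝ) : ℝ := ∑ k ∈ Finset.range (n + 1), questionTerm x k

theorem questionSum_succ {x : ℝ} (h : Int.fract x ≠ 0) (n : ℕ) :
    questionSum (n + 1) x = -(2 : ℝ) ^ (-⌊x⌋) * (1 + questionSum n (Int.fract x)⁻¹) := by
  rw [questionSum, Finset.sum_range_succ', questionTerm_zero]
  simp only [questionTerm_succ h]
  rw [← Finset.mul_sum, ← questionSum]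
  ring

theorem questionSum_of_fract_eq_zero {x : ℝ} (h : Int.fract x = 0) (n : ℕ) :
    questionSum n x = -(2 : ℝ) ^ (-⌊x⌋) := by
  rw [questionSum, Finset.sum_range_succ', questionTerm_zero]
  simp [questionTerm_succ_of_fract_eq_zero h]

theorem questionSum_bounds (n : ℕ) : ∀ x : ℝ,
    -(2 : ℝ) ^ (-⌊x⌋) ≤ questionSum n x ∧ questionSum n x ≤ -((2 : ℝ) ^ (-⌊x⌋) / 2) := by
  induction n with
  | zero =>
    intro x
    have hp : (0 : ℝ) < 2 ^ (-⌊x⌋) := by positivity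
    simp only [questionSum, zero_add, Finset.sum_range_one, questionTerm_zero]
    constructor <;> linarith
  | succ n ih =>
    intro x
    have hp : (0 : ℝ) < 2 ^ (-⌊x⌋) := by positivity
    by_cases h : Int.fract x = 0
    · rw [questionSum_of_fract_eq_zero h]
      constructor <;> linarith
    · rw [questionSum_succ h]
      obtain ⟨h1, h2⟩ := ih (Int.fract x)⁻¹
      have h3 := two_zpow_neg_le (one_le_floor_inv_fract h)
      have h4 : (2 : ℝ) ^ (-(1 : ℤ)) = 1 / 2 := by norm_num
      rw [h4] at h3
      have h5 : (0 : ℝ) < 2 ^ (-⌊(Int.fract x)⁻¹⌋) := by positivity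
      constructor <;> nlinarith

theorem monotone_questionSum (n : ℕ) : Monotone (questionSum n) := by
  induction n with
  | zero =>
    intro x y hxy
    simp only [questionSum, zero_add, Finset.sum_range_one, questionTerm_zero]
    have := two_zpow_neg_le (Int.floor_le_floor hxy)
    linarith
  | succ n ih =>
    intro x y hxy
    rcases (Int.floor_le_floor hxy).lt_or_eq with hlt | heq
    · have h1 := (questionSum_bounds (n + 1) x).2
      have h2 := (questionSum_bounds (n + 1) y).1
      have h3 : (2 : ℝ) ^ (-⌊y⌋) ≤ 2 ^ (-⌊x⌋) / 2 := by
        have := two_zpow_neg_le (show ⌊x⌋ + 1 ≤ ⌊y⌋ by omega)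
        rw [neg_add, zpow_add₀ (by norm_num : (2 : ℝ) ≠ 0)] at this
        norm_num at this ⊢
        linarith
      linarith
    · have hp : (0 : ℝ) < 2 ^ (-⌊y⌋) := by positivity
      have hfr : Int.fract x ≤ Int.fract y := by
        have e1 := Int.floor_add_fract x
        have e2 := Int.floor_add_fract y
        rw [heq] at e1
        linarith
      by_cases hx : Int.fract x = 0
      · rw [questionSum_of_fract_eq_zero hx, heq]
        exact (questionSum_bounds (n + 1) y).1
      · have hx' : 0 < Int.fract x := lt_of_le_of_ne (Int.fract_nonneg x) (Ne.symm hx)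
        have hy : Int.fract y ≠ 0 := (hx'.trans_le hfr).ne'
        rw [questionSum_succ hx, questionSum_succ hy, heq]
        have := ih (inv_anti₀ hx' hfr)
        nlinarith

theorem monotone_F : Monotone F := by
  intro x y hxy
  have hx := ((summable_questionTerm x).hasSum.tendsto_sum_nat).comp (Filter.tendsto_add_atTop_nat 1)
  have hy := ((summable_questionTerm y).hasSum.tendsto_sum_nat).comp (Filter.tendsto_add_atTop_nat 1)
  have := le_of_tendsto_of_tendsto' hx hy (fun n => monotone_questionSum n hxy)
  simpa [F] using this

/-- The measure `dF` on `[0, ∞)`: the Lebesgue-Stieltjes measure of the monotone function `F`,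
restricted to the half-line. -/
def dF : Measure ℝ := monotone_F.stieltjesFunction.measure.restrict (Set.Ici 0)

/-- The moment `M_L = ∫_0^∞ x^L dF(x)`. -/
def moment (L : ℕ) : ℝ := ∫ x, x ^ L ∂dF

/-- The function `Ψ(x) = 2^x (1 - F(x))`, which has period `1`. -/
def Psi (x : ℝ) : ℝ := (2 : ℝ) ^ x * (1 - F x)

/-- The Fourier coefficient `c_n = ∫_0^1 Ψ(x) e^(-2πinx) dx` of `Ψ`. -/
def c (n : ℤ) : ℂ := fourierCoeffOn (zero_lt_one : (0 : ℝ) < 1) (fun x => (Psi x : ℂ)) n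

/-- The `n`-th term `c_n / (log 2 - 2πin)^s` of the dyadic zeta series. The power is the
principal one; as `Re (log 2 - 2πin) > 0`, the argument used is the one in `(-π/2, π/2)`. -/
def zetaTerm (s : ℂ) (n : ℤ) : ℂ :=
  c n / ((Real.log 2 : ℂ) - 2 * (Real.pi : ℂ) * Complex.I * (n : ℂ)) ^ s

/-- The dyadic zeta series `∑_{n ∈ ℤ} c_n / (log 2 - 2πin)^s`, meant for `Re s > 0`. -/
def dyadicZeta (s : ℂ) : ℂ := ∑' n : ℤ, zetaTerm s n

end

end Minkowski

/-! ### Functional equations and bounds for `1 - F` -/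

namespace Minkowski

open MeasureTheory Set Filter Topology

/-! Two symmetries of `T = 1 - F` drive the theorem: `T(x+1) = T(x)/2`, and `T(1/x) = 1 - T(x)` for
`x > 1`.

The second one splits the Mellin transform of `T` at `1` and writes it as `1/s + A(s) - A(-s)` with
`A` entire. Multiplied by `s`, it becomes an entire even function `m(s)` (`complexMoment`), and
integration by parts identifies `m(s)` with `∫ x^s dF` for `Re s > 0`.

The first one says that `T(x) = 2^(-x) Ψ(x)` with `Ψ` periodic. Poisson summation for `x^(s-1)
2^(-x)`, whose Fourier transform is `Γ(s)` times a power of `log 2 + 2πiξ`, then gives `Γ(s) ζ(s) =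
∫ x^(s-1) T(x) dx` for `Re s > 1` (`Gamma_mul_dyadicZeta_of_one_lt_re`). Hence `ζ(s) = m(s)/Γ(s+1)`.
The right side is entire, and it agrees with the series on all of `Re s > 0` by the identity
theorem, because `c_n = O(1/n)`.

Everything else is read off this quotient: the functional equation from the evenness of `m`; the
values at `L` and the zeros and derivatives at `-L` from `m(±L) = M_L` and the zeros of `1/Γ`; the
growth from `|m(s)| ≤ |m(Re s)|` and a Stirling-type bound for `1/Γ`. -/

/-- The complement `1 - F` of the question mark function. -/
noncomputable def tail (x : ℝ) : ℝ := 1 - F x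

theorem tail_of_fract_eq_zero {x : ℝ} (h : Int.fract x = 0) : tail x = (2 : ℝ) ^ (-⌊x⌋) := by
  rw [tail, F, (summable_questionTerm x).tsum_eq_zero_add, questionTerm_zero]
  simp [questionTerm_succ_of_fract_eq_zero h]

/-- One step of the Gauss map: splitting off the `a_0` term leaves the series of the next complete
quotient. -/
theorem tail_of_fract_ne_zero {x : ℝ} (h : Int.fract x ≠ 0) :
    tail x = (2 : ℝ) ^ (-⌊x⌋) * F (Int.fract x)⁻¹ := by
  rw [tail, F, (summable_questionTerm x).tsum_eq_zero_add, questionTerm_zero]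
  simp only [questionTerm_succ h, tsum_mul_left]
  rw [F]
  ring

theorem antitone_tail : Antitone tail := fun _ _ h => sub_le_sub_left (monotone_F h) 1

theorem tail_add_one (x : ℝ) : tail (x + 1) = tail x / 2 := by
  have e : (2 : ℝ) ^ (-⌊x + 1⌋) = 2 ^ (-⌊x⌋) / 2 := by
    rw [Int.floor_add_one, neg_add, zpow_add₀ two_ne_zero]
    norm_num [div_eq_mul_inv]
  by_cases h : Int.fract x = 0
  · have h' : Int.fract (x + 1) = 0 := by rwa [Int.fract_add_one]
    rw [tail_of_fract_eq_zero h, tail_of_fract_eq_zero h', e]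
  · have h' : Int.fract (x + 1) ≠ 0 := by rwa [Int.fract_add_one]
    rw [tail_of_fract_ne_zero h, tail_of_fract_ne_zero h', e, Int.fract_add_one]
    ring

theorem tail_bounds (x : ℝ) : (2 : ℝ) ^ (-⌊x⌋) / 2 ≤ tail x ∧ tail x ≤ (2 : ℝ) ^ (-⌊x⌋) := by
  have h := ((summable_questionTerm x).hasSum.tendsto_sum_nat).comp
    (Filter.tendsto_add_atTop_nat 1)
  have h1 := ge_of_tendsto' h (fun n => (questionSum_bounds n x).1)
  have h2 := le_of_tendsto' h (fun n => (questionSum_bounds n x).2)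
  simp only [tail, F]
  constructor <;> linarith

theorem tail_pos (x : ℝ) : 0 < tail x := lt_of_lt_of_le (by positivity) (tail_bounds x).1

theorem tail_le (x : ℝ) : tail x ≤ 2 * (2 : ℝ) ^ (-x) := by
  refine (tail_bounds x).2.trans ?_
  have : (2 : ℝ) * 2 ^ (-x) = 2 ^ (1 - x) := by
    rw [sub_eq_add_neg, Real.rpow_add two_pos, Real.rpow_one]
  rw [this, ← Real.rpow_intCast]
  refine Real.rpow_le_rpow_of_exponent_le one_le_two ?_
  push_cast
  linarith [Int.lt_floor_add_one x]

theorem tail_le_one {x : ℝ} (hx : 0 ≤ x) : tail x ≤ 1 := by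
  refine (tail_bounds x).2.trans (zpow_le_one_of_nonpos₀ one_le_two ?_)
  have := Int.floor_nonneg.2 hx
  omega

/-- For `x > 1` the expansion of `x⁻¹` is that of `x` with a leading `0` inserted. This symmetry is
the source of the functional equation. -/
theorem tail_inv_of_one_lt {x : ℝ} (hx : 1 < x) : tail x⁻¹ = 1 - tail x := by
  have h0 : 0 < x⁻¹ := by positivity
  have hfr : Int.fract x⁻¹ = x⁻¹ := Int.fract_eq_self.2 ⟨h0.le, inv_lt_one_of_one_lt₀ hx⟩
  have hfl : ⌊x⁻¹⌋ = 0 := Int.floor_eq_zero_iff.2 ⟨h0.le, inv_lt_one_of_one_lt₀ hx⟩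
  rw [tail_of_fract_ne_zero (by rw [hfr]; exact h0.ne'), hfr, hfl, inv_inv, tail]
  simp

theorem Psi_add_one (x : ℝ) : Psi (x + 1) = Psi x := by
  have := tail_add_one x
  simp only [tail] at this
  rw [Psi, Psi, this, Real.rpow_add two_pos, Real.rpow_one]
  ring

theorem tail_eq_Psi (x : ℝ) : tail x = (2 : ℝ) ^ (-x) * Psi x := by
  rw [Psi, ← mul_assoc, ← Real.rpow_add two_pos]
  simp [tail]

/-! ### The Mellin transform of `1 - F` -/

/-- The Mellin transform of the part of `1 - F` on `(1, ∞)`. -/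
noncomputable def tailMellin (s : ℂ) : ℂ := mellin ((Ioi 1).indicator fun x => (tail x : ℂ)) s

theorem locallyIntegrableOn_tail : LocallyIntegrableOn (fun x => (tail x : ℂ)) (Ioi 0) :=
  fun x _ => by
    obtain ⟨t, ht, hi⟩ := antitone_tail.locallyIntegrable (μ := volume) x
    exact ⟨t, mem_nhdsWithin_of_mem_nhds ht, hi.ofReal⟩

theorem tail_isBigO_exp :
    (fun x => (tail x : ℂ)) =O[atTop] fun t => Real.exp (-(Real.log 2) * t) := by
  refine Asymptotics.IsBigO.of_bound 2 (Eventually.of_forall fun x => ?_)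
  rw [Complex.norm_real, Real.norm_of_nonneg (tail_pos x).le, Real.norm_of_nonneg
    (Real.exp_pos _).le]
  convert tail_le x using 2
  rw [Real.rpow_def_of_pos two_pos]
  ring_nf

theorem mellinConvergent_tail {s : ℂ} (hs : 0 < s.re) :
    MellinConvergent (fun x => (tail x : ℂ)) s := by
  refine mellinConvergent_of_isBigO_rpow_exp (b := 0) (Real.log_pos one_lt_two)
    locallyIntegrableOn_tail tail_isBigO_exp ?_ hs
  refine Asymptotics.IsBigO.of_bound 1 ?_
  filter_upwards [self_mem_nhdsWithin] with x hx
  rw [Complex.norm_real, Real.norm_of_nonneg (tail_pos x).le]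
  simpa using tail_le_one (le_of_lt hx)

/-- The truncated function vanishes near `0`, so it is bounded there by any power; the exponent is
chosen to put `s` inside the strip of convergence, whatever `s` is. -/
theorem tailMellin_aux (s : ℂ) :
    LocallyIntegrableOn ((Ioi 1).indicator fun x => (tail x : ℂ)) (Ioi 0) ∧
    ((Ioi 1).indicator fun x => (tail x : ℂ)) =O[atTop] (fun t => Real.exp (-(Real.log 2) * t)) ∧
    ((Ioi 1).indicator fun x => (tail x : ℂ)) =O[𝓝[>] 0] fun x : ℝ => x ^ (-(s.re - 1)) := by
  refine ⟨?_, ?_, ?_⟩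
  · intro x hx
    obtain ⟨t, ht, hi⟩ := locallyIntegrableOn_tail x hx
    exact ⟨t, ht, hi.indicator measurableSet_Ioi⟩
  · refine (Asymptotics.IsBigO.of_bound 1 (Eventually.of_forall fun x => ?_)).trans tail_isBigO_exp
    rw [one_mul]
    exact norm_indicator_le_norm_self _ _
  · refine Asymptotics.IsBigO.of_bound 1 ?_
    have : Ioo (0 : ℝ) 1 ∈ 𝓝[>] (0 : ℝ) := Ioo_mem_nhdsGT one_pos
    filter_upwards [this] with x hx
    rw [indicator_of_notMem (by simpa using hx.2.le)]
    simp

theorem mellinConvergent_indicator_tail (s : ℂ) :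
    MellinConvergent ((Ioi 1).indicator fun x => (tail x : ℂ)) s := by
  obtain ⟨h1, h2, h3⟩ := tailMellin_aux s
  exact mellinConvergent_of_isBigO_rpow_exp (Real.log_pos one_lt_two) h1 h2 h3 (by linarith)

theorem differentiable_tailMellin : Differentiable ℂ tailMellin := by
  intro s
  obtain ⟨h1, h2, h3⟩ := tailMellin_aux s
  exact mellin_differentiableAt_of_isBigO_rpow_exp (Real.log_pos one_lt_two) h1 h2 h3 (by linarith)

theorem mellinConvergent_comp_inv {f : ℝ → ℂ} {s : ℂ} (h : MellinConvergent f (-s)) :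
    MellinConvergent (fun x => f x⁻¹) s := by
  have := (MellinConvergent.comp_rpow (f := f) (s := s) (a := -1) (by norm_num)).2
    (by rwa [Complex.ofReal_neg, Complex.ofReal_one, div_neg, div_one])
  simpa [Real.rpow_neg_one] using this

/-- On `(0, 1)` the inversion symmetry replaces `tail x` by `1 - tail x⁻¹`. The constant contributes
`1/s`, and `x ↦ x⁻¹` turns the rest into the truncated transform at `-s`. -/
theorem mellin_tail {s : ℂ} (hs : 0 < s.re) :
    mellin (fun x => (tail x : ℂ)) s = 1 / s + tailMellin s - tailMellin (-s) := by
  set f : ℝ → ℂ := (Ioi 1).indicator fun x => (tail x : ℂ) with hf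
  have h1 := hasMellin_one_Ioc hs
  have h2 := hasMellin_add h1.1 (mellinConvergent_indicator_tail s)
  have h3 := hasMellin_sub h2.1 (mellinConvergent_comp_inv (mellinConvergent_indicator_tail (-s)))
  have h4 := h3.2
  rw [mellin_comp_inv, h2.2, h1.2] at h4
  rw [tailMellin, tailMellin, ← h4, mellin, mellin]
  refine integral_congr_ae ?_
  -- At `x = 1` the decomposition fails: it gives `1`, while `tail 1 = 1/2`.
  have hne : ∀ᵐ x : ℝ ∂volume.restrict (Ioi 0), x ≠ 1 :=
    ae_restrict_of_ae (Measure.ae_ne volume 1)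
  filter_upwards [hne, ae_restrict_mem measurableSet_Ioi] with x hx hx0
  have hx0 : 0 < x := hx0
  congr 1
  rcases lt_or_gt_of_ne hx with h | h
  · have hi : 1 < x⁻¹ := (one_lt_inv₀ hx0).2 h
    have := tail_inv_of_one_lt hi
    rw [inv_inv] at this
    rw [indicator_of_mem (show x ∈ Ioc (0 : ℝ) 1 from ⟨hx0, h.le⟩),
      indicator_of_notMem (by simpa using h.le), indicator_of_mem (show x⁻¹ ∈ Ioi (1 : ℝ) from hi),
      this]
    push_cast
    ring
  · have hi : x⁻¹ < 1 := inv_lt_one_of_one_lt₀ h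
    rw [indicator_of_notMem (fun h' => absurd h'.2 h.not_ge),
      indicator_of_mem (show x ∈ Ioi (1 : ℝ) from h), indicator_of_notMem (by simpa using hi.le)]
    ring

theorem mellin_conj (f : ℝ → ℝ) (s : ℂ) :
    mellin (fun x => (f x : ℂ)) (starRingEnd ℂ s) =
      starRingEnd ℂ (mellin (fun x => (f x : ℂ)) s) := by
  rw [mellin, mellin, ← integral_conj]
  refine setIntegral_congr_fun measurableSet_Ioi fun x hx => ?_
  have hx : 0 < x := hx
  simp only [smul_eq_mul, map_mul, Complex.conj_ofReal]
  have := Complex.cpow_conj (x : ℂ) (s - 1)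
    (by rw [Complex.arg_ofReal_of_nonneg hx.le]; exact Real.pi_pos.ne)
  rw [map_sub, map_one, Complex.conj_ofReal] at this
  rw [this]

theorem tailMellin_conj (s : ℂ) : tailMellin (starRingEnd ℂ s) = starRingEnd ℂ (tailMellin s) := by
  have : ((Ioi 1).indicator fun x => (tail x : ℂ)) =
      fun x => (((Ioi (1 : ℝ)).indicator tail x : ℝ) : ℂ) := by
    ext x
    by_cases hx : x ∈ Ioi (1 : ℝ) <;> simp [hx]
  rw [tailMellin, tailMellin, this, mellin_conj]

/-- The entire even function `s ↦ ∫_0^∞ x^s dF(x)`. -/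
noncomputable def complexMoment (s : ℂ) : ℂ := 1 + s * (tailMellin s - tailMellin (-s))

theorem differentiable_complexMoment : Differentiable ℂ complexMoment := by
  have h1 := differentiable_tailMellin
  have h2 : Differentiable ℂ fun s : ℂ => tailMellin (-s) := h1.comp differentiable_neg
  unfold complexMoment
  fun_prop

/-- This evenness is the functional equation before the Gamma factors are inserted. -/
theorem complexMoment_neg (s : ℂ) : complexMoment (-s) = complexMoment s := by
  rw [complexMoment, complexMoment, neg_neg]
  ring

theorem complexMoment_conj (s : ℂ) :
    complexMoment (starRingEnd ℂ s) = starRingEnd ℂ (complexMoment s) := by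
  simp only [complexMoment, ← map_neg, tailMellin_conj, map_add, map_mul, map_sub, map_one]

theorem complexMoment_eq_mellin {s : ℂ} (hs : 0 < s.re) :
    complexMoment s = s * mellin (fun x => (tail x : ℂ)) s := by
  have : s ≠ 0 := by rintro rfl; simp at hs
  rw [mellin_tail hs, complexMoment]
  field_simp
  ring

end Minkowski

/-! ### A Stirling-type bound for `1/Γ` in vertical strips -/

section InverseGammaBound

open Filter Topology Set

/-- One factor of the estimate for the product in Euler's limit formula. -/
theorem sq_add_sq_le_rpow_mul_rpow {u θ t : ℝ} (hu : 1 ≤ u) (h0 : 0 ≤ θ) (h1 : θ ≤ 1) :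
    (u + θ) ^ 2 + t ^ 2 ≤
      Real.exp (5 / u ^ 2) * ((u ^ 2 + t ^ 2) * (((u + 1) ^ 2 + t ^ 2) / (u ^ 2 + t ^ 2)) ^ θ) := by
  have hA : 0 < u ^ 2 + t ^ 2 := by positivity
  set A := u ^ 2 + t ^ 2 with hAdef
  set δ := (2 * u + 1) / A with hδ
  have hδ0 : 0 < δ := by positivity
  have hB : ((u + 1) ^ 2 + t ^ 2) / A = 1 + δ := by
    rw [hδ]; field_simp; rw [hAdef]; ring
  have hlog : δ - δ ^ 2 / 2 ≤ Real.log (1 + δ) := by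
    have := Real.le_log_one_add_of_nonneg hδ0.le
    refine le_trans ?_ this
    rw [le_div_iff₀ (by positivity)]
    nlinarith [pow_pos hδ0 3]
  -- Since `2u + 1 ≤ 3u`, the error `δ²/2` is at most `9/(2u²)`, which the constant `5` absorbs.
  have hδ2 : δ ^ 2 ≤ 9 / u ^ 2 := by
    have h3 : δ ≤ 3 / u := by
      rw [hδ, div_le_div_iff₀ hA (by positivity)]
      nlinarith [sq_nonneg t]
    calc δ ^ 2 ≤ (3 / u) ^ 2 := by gcongr
      _ = 9 / u ^ 2 := by rw [div_pow]; norm_num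
  have hpow : Real.exp (θ * δ - 5 / u ^ 2) ≤ (1 + δ) ^ θ := by
    rw [Real.rpow_def_of_pos (by positivity)]
    refine Real.exp_le_exp.2 ?_
    have h5 : (9 : ℝ) / u ^ 2 ≤ 10 / u ^ 2 := by gcongr; norm_num
    have h6 : (10 : ℝ) / u ^ 2 = 2 * (5 / u ^ 2) := by ring
    have h7 : θ * (δ - δ ^ 2 / 2) ≤ θ * Real.log (1 + δ) := mul_le_mul_of_nonneg_left hlog h0
    have h8 : θ * δ ^ 2 ≤ δ ^ 2 := mul_le_of_le_one_left (sq_nonneg _) h1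
    nlinarith
  rw [hB]
  -- `θ² ≤ θ` puts the left side below the chord in `θ` joining its values at `0` and `1`.
  calc (u + θ) ^ 2 + t ^ 2 ≤ A * (1 + θ * δ) := by
        have : A * (1 + θ * δ) = A + θ * (2 * u + 1) := by rw [hδ]; field_simp
        rw [this, hAdef]
        nlinarith
    _ ≤ A * Real.exp (θ * δ) := by
        gcongr
        linarith [Real.add_one_le_exp (θ * δ)]
    _ = Real.exp (5 / u ^ 2) * (A * Real.exp (θ * δ - 5 / u ^ 2)) := by
        rw [Real.exp_sub]
        field_simp
    _ ≤ _ := by gcongr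

theorem norm_sq_ofReal_add_mul_I (x y : ℝ) : ‖(x : ℂ) + y * Complex.I‖ ^ 2 = x ^ 2 + y ^ 2 := by
  rw [← Complex.normSq_eq_norm_sq, Complex.normSq_add_mul_I]

theorem sum_inv_sq_le_two (n : ℕ) : ∑ j ∈ Finset.range n, 1 / ((j : ℝ) + 1) ^ 2 ≤ 2 := by
  have : ∀ n : ℕ, ∑ j ∈ Finset.range (n + 1), 1 / ((j : ℝ) + 1) ^ 2 ≤ 2 - 1 / ((n : ℝ) + 1) := by
    intro n
    induction n with
    | zero => norm_num
    | succ n ih =>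
      rw [Finset.sum_range_succ]
      have : 1 / (((n + 1 : ℕ) : ℝ) + 1) ^ 2 ≤ 1 / ((n : ℝ) + 1) - 1 / (((n + 1 : ℕ) : ℝ) + 1) := by
        push_cast
        rw [div_sub_div _ _ (by positivity) (by positivity),
          div_le_div_iff₀ (by positivity) (by positivity)]
        ring_nf
        nlinarith [Nat.cast_nonneg (α := ℝ) n]
      linarith
  cases n with
  | zero => simp
  | succ n => exact (this n).trans (by have : 0 ≤ 1 / ((n : ℝ) + 1) := by positivity
                                       linarith)

/-- The one-factor estimate at `u = j + 1`, multiplied over `j`; the errors converge because `5 ∑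
1/(j+1)² ≤ 10`. -/
theorem prod_norm_le (θ t : ℝ) (h0 : 0 ≤ θ) (h1 : θ ≤ 1) (n : ℕ) :
    (∏ j ∈ Finset.range n, ‖((1 + θ + j : ℝ) : ℂ) + t * Complex.I‖) ^ 2 ≤
      Real.exp 10 * ((∏ j ∈ Finset.range n, ‖((1 + j : ℝ) : ℂ) + t * Complex.I‖) ^ 2 *
        ((∏ j ∈ Finset.range n, ‖((2 + j : ℝ) : ℂ) + t * Complex.I‖) ^ 2 /
          (∏ j ∈ Finset.range n, ‖((1 + j : ℝ) : ℂ) + t * Complex.I‖) ^ 2) ^ θ) := by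
  simp only [← Finset.prod_pow, norm_sq_ofReal_add_mul_I]
  rw [← Finset.prod_div_distrib, ← Real.finsetProd_rpow _ _ (fun i _ => by positivity),
    ← Finset.prod_mul_distrib]
  calc _ ≤ ∏ j ∈ Finset.range n, (Real.exp (5 / ((j : ℝ) + 1) ^ 2) * (((1 + (j : ℝ)) ^ 2 + t ^ 2) *
        (((2 + (j : ℝ)) ^ 2 + t ^ 2) / ((1 + (j : ℝ)) ^ 2 + t ^ 2)) ^ θ)) := by
        refine Finset.prod_le_prod (fun i _ => by positivity) fun j _ => ?_
        have := sq_add_sq_le_rpow_mul_rpow (u := j + 1) (t := t) (by simp) h0 h1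
        rw [add_comm (1 : ℝ) (j : ℝ), show 1 + θ + (j : ℝ) = j + 1 + θ by ring,
          show 2 + (j : ℝ) = j + 1 + 1 by ring]
        exact this
    _ = Real.exp (∑ j ∈ Finset.range n, 5 / ((j : ℝ) + 1) ^ 2) * _ := by
        rw [Finset.prod_mul_distrib, ← Real.exp_sum]
    _ ≤ _ := by
        refine mul_le_mul_of_nonneg_right (Real.exp_le_exp.2 ?_)
          (Finset.prod_nonneg fun i _ => by positivity)
        · have := sum_inv_sq_le_two n
          have e : ∑ j ∈ Finset.range n, 5 / ((j : ℝ) + 1) ^ 2 =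
            5 * ∑ j ∈ Finset.range n, 1 / ((j : ℝ) + 1) ^ 2 := by
            rw [Finset.mul_sum]; simp [div_eq_mul_inv]
          linarith

/-- The convexity bound between `Γ(1+it)` and `Γ(1+θ+it)`. -/
theorem norm_Gamma_sq_le (θ t : ℝ) (h0 : 0 ≤ θ) (h1 : θ ≤ 1) :
    ‖Complex.Gamma ((1 : ℝ) + t * Complex.I)‖ ^ 2 *
      (‖((1 : ℝ) : ℂ) + t * Complex.I‖ ^ 2) ^ θ ≤
      Real.exp 10 * ‖Complex.Gamma ((1 + θ : ℝ) + t * Complex.I)‖ ^ 2 := by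
  have hG : ∀ x : ℝ, Tendsto (fun n => ‖Complex.GammaSeq ((x : ℂ) + t * Complex.I) n‖ ^ 2) atTop
      (𝓝 (‖Complex.Gamma ((x : ℂ) + t * Complex.I)‖ ^ 2)) := fun x =>
    ((Complex.GammaSeq_tendsto_Gamma _).norm).pow 2
  have hN : ∀ x : ℝ, ∀ᶠ n : ℕ in atTop, ‖Complex.GammaSeq ((x : ℂ) + t * Complex.I) n‖ ^ 2 =
      ((n : ℝ) ^ x * n.factorial) ^ 2 /
        (∏ j ∈ Finset.range (n + 1), ‖((x + j : ℝ) : ℂ) + t * Complex.I‖) ^ 2 := by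
    intro x
    filter_upwards [eventually_gt_atTop 0] with n hn
    have hn' : (0 : ℝ) < n := by exact_mod_cast hn
    have e1 : ‖(n : ℂ) ^ ((x : ℂ) + t * Complex.I)‖ = (n : ℝ) ^ x := by
      rw [← Complex.ofReal_natCast, Complex.norm_cpow_eq_rpow_re_of_pos hn']
      simp
    rw [Complex.GammaSeq, norm_div, norm_mul, norm_prod, ← div_pow]
    rw [e1, Complex.norm_natCast]
    congr 2
    refine Finset.prod_congr rfl fun j _ => ?_
    congr 1; push_cast; ring
  have hne : ∀ x : ℝ, 0 < x → ‖Complex.Gamma ((x : ℂ) + t * Complex.I)‖ ^ 2 ≠ 0 := fun x hx =>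
    pow_ne_zero _ (norm_ne_zero_iff.2 (Complex.Gamma_ne_zero_of_re_pos (by simpa using hx)))
  -- Geometric interpolation between Euler's sequences at `1 + it` and `2 + it`; in the limit the
  -- ratio `Γ(2+it)/Γ(1+it)` is `1 + it`.
  have hlim := (hG 1).mul ((((hG 2).div (hG 1) (hne 1 one_pos))).rpow_const (p := θ)
    (Or.inl (div_ne_zero (hne 2 two_pos) (hne 1 one_pos))))
  have key := le_of_tendsto_of_tendsto hlim ((hG (1 + θ)).const_mul (Real.exp 10)) (by
    filter_upwards [hN 1, hN 2, hN (1 + θ), eventually_gt_atTop 0] with n e1 e2 e3 hn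
    have hn' : (0 : ℝ) < n := by exact_mod_cast hn
    have hP : ∀ x : ℝ, 0 < x →
        0 < (∏ j ∈ Finset.range (n + 1), ‖((x + j : ℝ) : ℂ) + t * Complex.I‖) ^ 2 := fun x hx => by
      refine pow_pos (Finset.prod_pos fun j _ => norm_pos_iff.2 fun h => ?_) 2
      have := congrArg Complex.re h
      simp at this
      linarith [Nat.cast_nonneg (α := ℝ) j]
    have hle := prod_norm_le θ t h0 h1 (n + 1)
    simp only [Pi.div_apply]
    rw [e1, e2, e3]
    set P1 := (∏ j ∈ Finset.range (n + 1), ‖((1 + j : ℝ) : ℂ) + t * Complex.I‖) ^ 2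
    set P2 := (∏ j ∈ Finset.range (n + 1), ‖((2 + j : ℝ) : ℂ) + t * Complex.I‖) ^ 2
    set P3 := (∏ j ∈ Finset.range (n + 1), ‖((1 + θ + j : ℝ) : ℂ) + t * Complex.I‖) ^ 2
    have p1 : 0 < P1 := hP 1 one_pos
    have p2 : 0 < P2 := hP 2 two_pos
    have p3 : 0 < P3 := hP (1 + θ) (by linarith)
    have hf : (0 : ℝ) < n.factorial := by positivity
    have eq : ((n : ℝ) ^ (2 : ℝ) * n.factorial) ^ 2 / P2 / (((n : ℝ) ^ (1 : ℝ) * n.factorial) ^ 2 / P1)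
        = (n : ℝ) ^ 2 * (P2 / P1)⁻¹ := by
      rw [Real.rpow_one, Real.rpow_two]
      field_simp
    rw [eq, Real.mul_rpow (by positivity) (by positivity), Real.inv_rpow (by positivity),
      Real.rpow_add hn', Real.rpow_one, ← Real.rpow_natCast_mul hn'.le]
    rw [mul_comm ((2 : ℕ) : ℝ) θ, Real.rpow_mul_natCast hn'.le]
    set Q := (P2 / P1) ^ θ
    have q : 0 < Q := by positivity
    have : ((n : ℝ) * n.factorial) ^ 2 / P1 * (((n : ℝ) ^ θ) ^ 2 * Q⁻¹) =
        ((n : ℝ) * (n : ℝ) ^ θ * n.factorial) ^ 2 / (P1 * Q) := by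
      field_simp
    rw [this, mul_div_assoc', div_le_div_iff₀ (by positivity) p3]
    have := mul_le_mul_of_nonneg_left hle (sq_nonneg ((n : ℝ) * (n : ℝ) ^ θ * n.factorial))
    linarith)
  refine le_trans (le_of_eq ?_) key
  congr 2
  rw [eq_div_iff (hne 1 one_pos), ← mul_pow, ← norm_mul, ← Complex.Gamma_add_one]
  · push_cast; ring_nf
  · intro h
    have := congrArg Complex.re h
    simp at this

/-- `Γ(1+it)` and `Γ(1-it)` are conjugate, and the reflection formula evaluates their product. -/
theorem norm_Gamma_one_add_mul_I_sq {t : ℝ} (ht : t ≠ 0) :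
    ‖Complex.Gamma ((1 : ℝ) + t * Complex.I)‖ ^ 2 = Real.pi * t / Real.sinh (Real.pi * t) := by
  have h1 : (t : ℂ) * Complex.I ≠ 0 := mul_ne_zero (by exact_mod_cast ht) Complex.I_ne_zero
  have h := Complex.Gamma_mul_Gamma_one_sub (t * Complex.I)
  have hc : starRingEnd ℂ ((1 : ℝ) + t * Complex.I) = 1 - t * Complex.I := by
    simp [sub_eq_add_neg]
  have e : ((‖Complex.Gamma ((1 : ℝ) + t * Complex.I)‖ ^ 2 : ℝ) : ℂ) =
      Complex.Gamma (t * Complex.I + 1) * Complex.Gamma (1 - t * Complex.I) := by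
    rw [← hc, Complex.Gamma_conj, add_comm (t * Complex.I : ℂ) 1, ← Complex.ofReal_one,
      Complex.mul_conj, Complex.normSq_eq_norm_sq]
  rw [Complex.Gamma_add_one _ h1, mul_assoc, h, ← mul_assoc, Complex.sin_mul_I] at e
  apply Complex.ofReal_injective
  rw [e]
  push_cast
  field_simp

theorem le_norm_Gamma_one_add_mul_I_sq {t : ℝ} (ht : t ≠ 0) :
    2 * Real.pi * |t| * Real.exp (-(Real.pi * |t|)) ≤
      ‖Complex.Gamma ((1 : ℝ) + t * Complex.I)‖ ^ 2 := by
  rw [norm_Gamma_one_add_mul_I_sq ht]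
  have e : Real.pi * t / Real.sinh (Real.pi * t) = Real.pi * |t| / Real.sinh (Real.pi * |t|) := by
    rcases abs_choice t with h | h <;> rw [h]
    rw [mul_neg, Real.sinh_neg, neg_div_neg_eq]
  have hp : 0 < Real.pi * |t| := by positivity
  rw [e, le_div_iff₀ (Real.sinh_pos_iff.2 hp), Real.sinh_eq]
  have : Real.exp (-(Real.pi * |t|)) * Real.exp (Real.pi * |t|) = 1 := by
    rw [← Real.exp_add]; simp
  have h2 := Real.exp_pos (-(Real.pi * |t|))
  nlinarith [mul_pos hp (mul_pos h2 h2)]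

theorem norm_inv_Gamma_one_add_le {θ t : ℝ} (h0 : 0 ≤ θ) (h1 : θ ≤ 1) (ht : t ≠ 0) :
    ‖(Complex.Gamma (θ + t * Complex.I + 1))⁻¹‖ ≤
      Real.exp 5 * |t| ^ (-θ - 1 / 2) * Real.exp (Real.pi * |t| / 2) := by
  have htp : 0 < |t| := abs_pos.2 ht
  refine le_of_sq_le_sq ?_ (by positivity)
  have hG := norm_Gamma_sq_le θ t h0 h1
  have hL := le_norm_Gamma_one_add_mul_I_sq ht
  have ht2 : (|t| ^ θ) ^ 2 ≤ (‖((1 : ℝ) : ℂ) + t * Complex.I‖ ^ 2) ^ θ := by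
    rw [norm_sq_ofReal_add_mul_I, ← Real.rpow_mul_natCast htp.le, mul_comm,
      Real.rpow_natCast_mul htp.le, sq_abs]
    exact Real.rpow_le_rpow (sq_nonneg t) (by linarith) h0
  have e1 : (θ : ℂ) + t * Complex.I + 1 = ((1 + θ : ℝ) : ℂ) + t * Complex.I := by
    push_cast; ring
  rw [e1]
  set G := ‖Complex.Gamma (((1 + θ : ℝ) : ℂ) + t * Complex.I)‖
  have hchain : 2 * Real.pi * |t| * Real.exp (-(Real.pi * |t|)) * (|t| ^ θ) ^ 2 ≤
      Real.exp 10 * G ^ 2 :=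
    (mul_le_mul hL ht2 (by positivity) (by positivity)).trans hG
  have hGpos : 0 < G := norm_pos_iff.2 (Complex.Gamma_ne_zero_of_re_pos (by simp; linarith))
  have e2 : |t| ^ (-θ - 1 / 2) = (|t| ^ θ)⁻¹ * (|t| ^ (1 / 2 : ℝ))⁻¹ := by
    rw [sub_eq_add_neg, Real.rpow_add htp, Real.rpow_neg htp.le, Real.rpow_neg htp.le]
  have e3 : (|t| ^ (1 / 2 : ℝ)) ^ 2 = |t| := by
    rw [← Real.rpow_mul_natCast htp.le]; norm_num
  have e4 : Real.exp 5 ^ 2 = Real.exp 10 := by rw [← Real.exp_nat_mul]; norm_num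
  have e5 : Real.exp (Real.pi * |t| / 2) ^ 2 = (Real.exp (-(Real.pi * |t|)))⁻¹ := by
    rw [← Real.exp_nat_mul, ← Real.exp_neg]; congr 1; push_cast; ring
  rw [norm_inv, e2, inv_pow, mul_pow, mul_pow, mul_pow, inv_pow, inv_pow, e3, e4, e5]
  set X := |t| ^ θ
  have hX : 0 < X := Real.rpow_pos_of_pos htp θ
  have hE := Real.exp_pos (-(Real.pi * |t|))
  have hpi : 1 ≤ 2 * Real.pi := by linarith [Real.pi_gt_three]
  have hW : 0 < |t| * Real.exp (-(Real.pi * |t|)) * X ^ 2 := by positivity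
  have : Real.exp 10 * ((X ^ 2)⁻¹ * |t|⁻¹) * (Real.exp (-(Real.pi * |t|)))⁻¹ =
      Real.exp 10 / (|t| * Real.exp (-(Real.pi * |t|)) * X ^ 2) := by
    field_simp
  rw [this, inv_eq_one_div, div_le_div_iff₀ (by positivity) hW, one_mul]
  nlinarith

/-- The bound for `1/Γ` in vertical strips given by Stirling's formula. -/
theorem exists_norm_inv_Gamma_le (a b : ℝ) : ∃ C : ℝ, 0 ≤ C ∧ ∀ σ t : ℝ, a ≤ σ → σ ≤ b → 1 ≤ |t| →
    ‖(Complex.Gamma (σ + t * Complex.I + 1))⁻¹‖ ≤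
      C * |t| ^ (-σ - 1 / 2) * Real.exp (Real.pi * |t| / 2) := by
  have unit : ∀ k : ℤ, ∃ C : ℝ, 0 ≤ C ∧ ∀ σ t : ℝ, (k : ℝ) ≤ σ → σ ≤ k + 1 → 1 ≤ |t| →
      ‖(Complex.Gamma (σ + t * Complex.I + 1))⁻¹‖ ≤
        C * |t| ^ (-σ - 1 / 2) * Real.exp (Real.pi * |t| / 2) := by
    intro k
    -- The recursion `1/Γ(s) = s/Γ(s+1)` carries the bound from `[0, 1]` to the other unit strips:
    -- `|s| ≥ |t|` suffices for moving right, `|s| ≤ (k+2)|t|` for moving left.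
    induction k using Int.induction_on with
    | zero =>
      refine ⟨Real.exp 5, (Real.exp_pos _).le, fun σ t h0 h1 ht => ?_⟩
      exact norm_inv_Gamma_one_add_le (by simpa using h0) (by simpa using h1)
        (by rintro rfl; simp at ht; linarith)
    | succ k ih =>
      obtain ⟨C, hC, h⟩ := ih
      refine ⟨C, hC, fun σ t h0 h1 ht => ?_⟩
      push_cast at h0 h1 h
      have htp : 0 < |t| := by linarith
      have := h (σ - 1) t (by linarith) (by linarith) ht
      have e : ((σ - 1 : ℝ) : ℂ) + t * Complex.I + 1 = σ + t * Complex.I := by push_cast; ring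
      rw [e, Complex.one_div_Gamma_eq_self_mul_one_div_Gamma_add_one, norm_mul] at this
      have hn : |t| ≤ ‖(σ : ℂ) + t * Complex.I‖ := by
        simpa using Complex.abs_im_le_norm ((σ : ℂ) + t * Complex.I)
      have e2 : |t| ^ (-(σ - 1) - 1 / 2) = |t| * |t| ^ (-σ - 1 / 2) := by
        rw [← Real.rpow_one_add' htp.le (by linarith)]
        ring_nf
      rw [e2] at this
      refine le_of_mul_le_mul_left ?_ htp
      calc _ ≤ _ := mul_le_mul_of_nonneg_right hn (norm_nonneg _)
        _ ≤ _ := this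
        _ = _ := by ring
    | pred k ih =>
      obtain ⟨C, hC, h⟩ := ih
      refine ⟨(k + 2) * C, by positivity, fun σ t h0 h1 ht => ?_⟩
      push_cast at h0 h1 h
      have htp : 0 < |t| := by linarith
      have := h (σ + 1) t (by linarith) (by linarith) ht
      have e : ((σ + 1 : ℝ) : ℂ) + t * Complex.I + 1 = σ + t * Complex.I + 1 + 1 := by
        push_cast; ring
      rw [e] at this
      rw [Complex.one_div_Gamma_eq_self_mul_one_div_Gamma_add_one, norm_mul]
      have hn : ‖(σ : ℂ) + t * Complex.I + 1‖ ≤ (k + 2) * |t| := by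
        refine (Complex.norm_le_abs_re_add_abs_im _).trans ?_
        have : |σ + 1| ≤ k + 1 := abs_le.2 ⟨by linarith, by linarith⟩
        have h3 : ((k : ℝ) + 1) * 1 ≤ (k + 1) * |t| := by gcongr
        simp
        linarith
      have e2 : |t| ^ (-(σ + 1) - 1 / 2) = |t|⁻¹ * |t| ^ (-σ - 1 / 2) := by
        rw [← Real.rpow_neg_one, ← Real.rpow_add htp]
        ring_nf
      rw [e2] at this
      calc _ ≤ _ := mul_le_mul hn this (norm_nonneg _) (by positivity)
        _ = _ := by field_simp
  choose C hC h using unit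
  refine ⟨∑ k ∈ Finset.Icc ⌊a⌋ ⌊b⌋, C k, Finset.sum_nonneg fun k _ => hC k, fun σ t h0 h1 ht => ?_⟩
  refine (h ⌊σ⌋ σ t (Int.floor_le σ) (Int.lt_floor_add_one σ).le ht).trans ?_
  gcongr
  exact Finset.single_le_sum (f := C) (fun k _ => hC k)
    (Finset.mem_Icc.2 ⟨Int.floor_le_floor h0, Int.floor_le_floor h1⟩)

end InverseGammaBound

namespace Minkowski

open MeasureTheory Set Filter Topology

/-! ### Integration against `dF` -/

theorem tendsto_F_atTop : Tendsto F atTop (𝓝 1) := by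
  have h : Tendsto (fun x : ℝ => 1 - 2 * (2 : ℝ) ^ (-x)) atTop (𝓝 (1 - 2 * 0)) := by
    refine Tendsto.const_sub 1 (Tendsto.const_mul 2 ?_)
    exact (tendsto_rpow_atBot_of_base_gt_one 2 one_lt_two).comp tendsto_neg_atTop_atBot
  rw [mul_zero, sub_zero] at h
  refine tendsto_of_tendsto_of_tendsto_of_le_of_le h tendsto_const_nhds (fun x => ?_) fun x => ?_
  · have := tail_le x
    simp only [tail] at this
    show 1 - 2 * (2 : ℝ) ^ (-x) ≤ F x
    linarith
  · have := tail_pos x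
    simp only [tail] at this
    show F x ≤ 1
    linarith

theorem tendsto_stieltjes_atTop : Tendsto monotone_F.stieltjesFunction atTop (𝓝 1) := by
  have h2 : Tendsto (fun x : ℝ => F (x + 1)) atTop (𝓝 1) :=
    tendsto_F_atTop.comp (tendsto_atTop_add_const_right _ 1 tendsto_id)
  refine tendsto_of_tendsto_of_tendsto_of_le_of_le tendsto_F_atTop h2 (fun x => ?_) fun x => ?_
  · rw [monotone_F.stieltjesFunction_eq]
    exact monotone_F.le_rightLim le_rfl
  · rw [monotone_F.stieltjesFunction_eq]
    exact monotone_F.rightLim_le (by linarith)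

instance isFiniteMeasure_dF : IsFiniteMeasure dF := by
  refine ⟨?_⟩
  rw [dF, Measure.restrict_apply_univ,
    StieltjesFunction.measure_Ici _ tendsto_stieltjes_atTop]
  exact ENNReal.ofReal_lt_top

/-- The measure of `(y, ∞)` is `1` minus the right limit of `F` at `y`, and a monotone function has
only countably many discontinuities. Almost every `y` is enough under a Lebesgue integral, so
continuity of `F` is never needed. -/
theorem dF_real_Ioi_ae :
    ∀ᵐ y ∂(volume.restrict (Ioi (0 : ℝ))), dF.real (Ioi y) = tail y := by
  have hc : ∀ᵐ y : ℝ, ContinuousAt F y := by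
    rw [ae_iff]
    exact monotone_F.countable_not_continuousAt.measure_zero _
  filter_upwards [ae_restrict_of_ae hc, ae_restrict_mem measurableSet_Ioi] with y hy hy0
  have hy0 : 0 < y := hy0
  rw [measureReal_def, dF, Measure.restrict_apply measurableSet_Ioi,
    inter_eq_left.2 (show Ioi y ⊆ Ici 0 from fun x hx => (hy0.trans hx).le),
    StieltjesFunction.measure_Ioi _ tendsto_stieltjes_atTop, monotone_F.stieltjesFunction_eq,
    hy.continuousWithinAt.rightLim_eq, ← tail, ENNReal.toReal_ofReal (tail_pos y).le]

/-- Integration by parts against `dF`. -/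
theorem integral_primitive_dF {h : ℝ → ℂ} (hm : Measurable h)
    (hi : IntegrableOn (fun y => h y * tail y) (Ioi 0)) :
    Integrable (fun x => ∫ y in Ioi 0, (Iio x).indicator h y) dF ∧
    ∫ x, (∫ y in Ioi 0, (Iio x).indicator h y) ∂dF = ∫ y in Ioi 0, h y * tail y := by
  -- Fubini for `h(y)` on `{y < x}`: integrating in `x` first yields `h(y)` times the `dF`-mass of
  -- `(y, ∞)`.
  set f : ℝ → ℝ → ℂ := fun x y => (Iio x).indicator h y with hf
  have hsec : ∀ y, (fun x => f x y) = (Ioi y).indicator fun _ => h y := by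
    intro y; ext x
    by_cases hxy : y < x
    · simp [hf, hxy]
    · simp [hf, hxy]
  have hmeas : Measurable (Function.uncurry f) := by
    have : Function.uncurry f = {p : ℝ × ℝ | p.2 < p.1}.indicator fun p => h p.2 := by
      ext p
      by_cases hp : p.2 < p.1
      · simp [hf, Function.uncurry, hp]
      · simp [hf, Function.uncurry, hp]
    rw [this]
    exact (hm.comp measurable_snd).indicator (measurableSet_lt measurable_snd measurable_fst)
  have hint : Integrable (Function.uncurry f) (dF.prod (volume.restrict (Ioi 0))) := by
    rw [integrable_prod_iff' hmeas.aestronglyMeasurable]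
    constructor
    · refine Eventually.of_forall fun y => ?_
      show Integrable (fun x => f x y) dF
      rw [hsec]
      exact (integrable_const _).indicator measurableSet_Ioi
    · refine hi.norm.congr ?_
      filter_upwards [dF_real_Ioi_ae] with y hy
      show _ = ∫ x, ‖f x y‖ ∂dF
      have : (fun x => ‖f x y‖) = (Ioi y).indicator fun _ => ‖h y‖ := by
        ext x
        rw [show f x y = (Ioi y).indicator (fun _ => h y) x from congrFun (hsec y) x,
          norm_indicator_eq_indicator_norm]
      rw [this, integral_indicator_const _ measurableSet_Ioi, hy, norm_mul, Complex.norm_real,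
        Real.norm_of_nonneg (tail_pos y).le, smul_eq_mul, mul_comm]
  refine ⟨hint.integral_prod_left, ?_⟩
  refine (integral_integral_swap hint).trans ?_
  refine integral_congr_ae ?_
  filter_upwards [dF_real_Ioi_ae] with y hy
  rw [show (∫ x, f x y ∂dF) = ∫ x, (Ioi y).indicator (fun _ => h y) x ∂dF by rw [← hsec],
    integral_indicator_const _ measurableSet_Ioi, hy, Complex.real_smul, mul_comm]

theorem dF_nonneg_ae : ∀ᵐ x ∂dF, 0 ≤ x := ae_restrict_mem measurableSet_Ici

theorem integral_primitive_cpow {s : ℂ} (hs : 0 < s.re) {x : ℝ} (hx : 0 ≤ x) :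
    ∫ y in Ioi 0, (Iio x).indicator (fun y : ℝ => s * (y : ℂ) ^ (s - 1)) y = (x : ℂ) ^ s := by
  have hs0 : s ≠ 0 := by rintro rfl; simp at hs
  rw [setIntegral_indicator measurableSet_Iio, Ioi_inter_Iio, ← integral_Ioc_eq_integral_Ioo,
    ← intervalIntegral.integral_of_le hx, intervalIntegral.integral_const_mul,
    integral_cpow (Or.inl (by simpa using hs))]
  simp [hs0]
  field_simp

theorem complexMoment_eq_integral {s : ℂ} (hs : 0 < s.re) :
    Integrable (fun x : ℝ => (x : ℂ) ^ s) dF ∧ complexMoment s = ∫ x : ℝ, (x : ℂ) ^ s ∂dF := by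
  have hm : Measurable fun y : ℝ => s * (y : ℂ) ^ (s - 1) := by fun_prop
  have hi : IntegrableOn (fun y : ℝ => s * (y : ℂ) ^ (s - 1) * (tail y : ℂ)) (Ioi 0) := by
    simp only [mul_assoc]
    exact (mellinConvergent_tail hs).const_mul s
  obtain ⟨h1, h2⟩ := integral_primitive_dF hm hi
  have hae : (fun x => ∫ y in Ioi 0, (Iio x).indicator (fun y : ℝ => s * (y : ℂ) ^ (s - 1)) y)
      =ᵐ[dF] fun x : ℝ => (x : ℂ) ^ s := by
    filter_upwards [dF_nonneg_ae] with x hx using integral_primitive_cpow hs hx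
  refine ⟨h1.congr hae, ?_⟩
  rw [← integral_congr_ae hae, h2, complexMoment_eq_mellin hs, mellin, ← integral_const_mul]
  simp only [smul_eq_mul, mul_assoc]

theorem complexMoment_natCast {L : ℕ} (hL : 1 ≤ L) :
    Integrable (fun x : ℝ => x ^ L) dF ∧ complexMoment L = moment L := by
  obtain ⟨h1, h2⟩ := complexMoment_eq_integral (s := L) (by simp; omega)
  have e : (fun x : ℝ => (x : ℂ) ^ (L : ℂ)) = fun x : ℝ => ((x ^ L : ℝ) : ℂ) := by
    ext x; simp
  rw [e] at h1 h2
  refine ⟨by simpa only [RCLike.re_to_complex, Complex.ofReal_re] using h1.re, ?_⟩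
  rw [h2, moment, integral_complex_ofReal]

/-! ### Boundedness of the complex moment in vertical strips -/

theorem norm_complexMoment_le_of_re_pos {s : ℂ} (hs : 0 < s.re) :
    ‖complexMoment s‖ ≤ ‖complexMoment (s.re : ℂ)‖ := by
  have hr : 0 < ((s.re : ℝ) : ℂ).re := by simpa using hs
  rw [(complexMoment_eq_integral hs).2, (complexMoment_eq_integral hr).2]
  have e : (fun x : ℝ => (x : ℂ) ^ ((s.re : ℝ) : ℂ)) =ᵐ[dF] fun x : ℝ => ((x ^ s.re : ℝ) : ℂ) := by
    filter_upwards [dF_nonneg_ae] with x hx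
    rw [Complex.ofReal_cpow hx]
  rw [integral_congr_ae e, integral_complex_ofReal, Complex.norm_real]
  refine (norm_integral_le_integral_norm _).trans ?_
  refine (le_of_eq (integral_congr_ae ?_)).trans (le_abs_self _)
  filter_upwards [dF_nonneg_ae] with x hx
  exact Complex.norm_cpow_eq_rpow_re_of_nonneg hx hs.ne'

/-- Evenness reduces `Re s < 0` to `Re s > 0`, where `|x^s| = x^(Re s)`; the imaginary axis is a
limit from the right. -/
theorem norm_complexMoment_le (s : ℂ) : ‖complexMoment s‖ ≤ ‖complexMoment (s.re : ℂ)‖ := by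
  rcases lt_trichotomy s.re 0 with h | h | h
  · have := norm_complexMoment_le_of_re_pos (s := -s) (by simpa using h)
    rw [complexMoment_neg, Complex.neg_re, Complex.ofReal_neg, complexMoment_neg] at this
    exact this
  · have hc := differentiable_complexMoment.continuous
    have t1 : Tendsto (fun ε : ℝ => ‖complexMoment (s + ε)‖) (𝓝[>] 0) (𝓝 ‖complexMoment s‖) := by
      have : Continuous fun ε : ℝ => ‖complexMoment (s + ε)‖ := by fun_prop
      simpa using (this.tendsto 0).mono_left nhdsWithin_le_nhds
    have t2 : Tendsto (fun ε : ℝ => ‖complexMoment ((s + ε).re : ℝ)‖) (𝓝[>] 0)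
        (𝓝 ‖complexMoment (s.re : ℝ)‖) := by
      have : Continuous fun ε : ℝ => ‖complexMoment ((s + ε).re : ℝ)‖ := by fun_prop
      simpa using (this.tendsto 0).mono_left nhdsWithin_le_nhds
    refine le_of_tendsto_of_tendsto t1 t2 ?_
    filter_upwards [self_mem_nhdsWithin] with ε hε
    have hε : 0 < ε := hε
    exact norm_complexMoment_le_of_re_pos (by simpa [h] using hε)
  · exact norm_complexMoment_le_of_re_pos h

theorem exists_norm_complexMoment_le (a b : ℝ) :
    ∃ C : ℝ, 0 ≤ C ∧ ∀ s : ℂ, a ≤ s.re → s.re ≤ b → ‖complexMoment s‖ ≤ C := by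
  have hc : Continuous fun x : ℝ => complexMoment x :=
    differentiable_complexMoment.continuous.comp Complex.continuous_ofReal
  obtain ⟨C, hC⟩ := isCompact_Icc.exists_bound_of_continuousOn (s := Icc a b) hc.continuousOn
  refine ⟨max C 0, le_max_right _ _, fun s h1 h2 => ?_⟩
  exact (norm_complexMoment_le s).trans ((hC s.re ⟨h1, h2⟩).trans (le_max_left _ _))

end Minkowski

namespace Minkowski

open MeasureTheory Set Filter Topology

/-! ### The Laplace transform of a power -/

theorem integrableOn_rpow_mul_exp {σ b : ℝ} (hσ : 0 < σ) (hb : 0 < b) :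
    IntegrableOn (fun x : ℝ => x ^ (σ - 1) * Real.exp (-b * x)) (Ioi 0) := by
  simpa using integrableOn_rpow_mul_exp_neg_mul_rpow (s := σ - 1) (p := 1) (by linarith) one_pos hb

theorem norm_cpow_mul_exp {s r : ℂ} {x : ℝ} (hx : 0 < x) :
    ‖(x : ℂ) ^ (s - 1) * Complex.exp (-(r * x))‖ =
      x ^ (s.re - 1) * Real.exp (-r.re * x) := by
  rw [norm_mul, Complex.norm_cpow_eq_rpow_re_of_pos hx, Complex.norm_exp]
  simp

theorem integrableOn_cpow_mul_exp {s r : ℂ} (hs : 0 < s.re) (hr : 0 < r.re) :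
    IntegrableOn (fun x : ℝ => (x : ℂ) ^ (s - 1) * Complex.exp (-(r * x))) (Ioi 0) := by
  refine (integrableOn_rpow_mul_exp hs hr).mono' (by fun_prop) ?_
  filter_upwards [ae_restrict_mem measurableSet_Ioi] with x hx
  exact (norm_cpow_mul_exp hx).le

theorem differentiableAt_laplace_cpow {s r : ℂ} (hs : 0 < s.re) (hr : 0 < r.re) :
    DifferentiableAt ℂ
      (fun r : ℂ => ∫ x : ℝ in Ioi 0, (x : ℂ) ^ (s - 1) * Complex.exp (-(r * x))) r := by
  have hs1 : 0 < (s + 1).re := by simp; linarith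
  have hU : {z : ℂ | r.re / 2 < z.re} ∈ 𝓝 r :=
    (isOpen_lt continuous_const Complex.continuous_re).mem_nhds (by
      show r.re / 2 < r.re
      linarith)
  refine (hasDerivAt_integral_of_dominated_loc_of_deriv_le
    (F := fun (r : ℂ) (x : ℝ) => (x : ℂ) ^ (s - 1) * Complex.exp (-(r * x)))
    (F' := fun (r : ℂ) (x : ℝ) => (x : ℂ) ^ (s - 1) * (Complex.exp (-(r * x)) * (-(1 * x))))
    -- Differentiating in `r` costs a factor `x`, hence `s + 1`; the rate `r.re / 2` serves a whole
    -- neighbourhood of `r`.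
    (bound := fun x : ℝ => x ^ ((s + 1).re - 1) * Real.exp (-(r.re / 2) * x))
    hU (Eventually.of_forall fun z => by fun_prop) (integrableOn_cpow_mul_exp hs hr)
    (by fun_prop) ?_ (integrableOn_rpow_mul_exp hs1 (by linarith)) ?_).2.differentiableAt
  · filter_upwards [ae_restrict_mem measurableSet_Ioi] with x hx z hz
    have hx : 0 < x := hx
    have hz : r.re / 2 < z.re := hz
    rw [← mul_assoc, norm_mul, norm_cpow_mul_exp hx, one_mul, norm_neg, Complex.norm_real,
      Real.norm_of_nonneg hx.le, mul_right_comm, ← Real.rpow_add_one hx.ne']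
    have e : s.re - 1 + 1 = (s + 1).re - 1 := by simp
    rw [e]
    gcongr
  · refine Eventually.of_forall fun x z _ => ?_
    exact ((((hasDerivAt_id z).mul_const (x : ℂ)).neg).cexp).const_mul _

theorem isPreconnected_re_pos : IsPreconnected {z : ℂ | 0 < z.re} :=
  (convex_halfSpace_re_gt 0).isPreconnected

theorem isOpen_re_pos : IsOpen {z : ℂ | 0 < z.re} :=
  isOpen_lt continuous_const Complex.continuous_re

/-- Both sides are analytic in `r` on the right half plane and agree at real `r` near `1`, so the
identity theorem applies. -/
theorem laplace_cpow {s r : ℂ} (hs : 0 < s.re) (hr : 0 < r.re) :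
    ∫ x : ℝ in Ioi 0, (x : ℂ) ^ (s - 1) * Complex.exp (-(r * x)) = (1 / r) ^ s * Complex.Gamma s := by
  have h1 : AnalyticOnNhd ℂ
      (fun r : ℂ => ∫ x : ℝ in Ioi 0, (x : ℂ) ^ (s - 1) * Complex.exp (-(r * x)))
      {z : ℂ | 0 < z.re} :=
    DifferentiableOn.analyticOnNhd
      (fun z hz => (differentiableAt_laplace_cpow hs hz).differentiableWithinAt) isOpen_re_pos
  have h2 : AnalyticOnNhd ℂ (fun r : ℂ => (1 / r) ^ s * Complex.Gamma s) {z : ℂ | 0 < z.re} := by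
    refine DifferentiableOn.analyticOnNhd (fun z hz => ?_) isOpen_re_pos
    have hz : 0 < z.re := hz
    have hz0 : z ≠ 0 := by rintro rfl; simp at hz
    have hz1 : 1 / z ∈ Complex.slitPlane := Or.inl (by
      rw [one_div, Complex.inv_re]
      exact div_pos hz (Complex.normSq_pos.2 hz0))
    refine DifferentiableAt.differentiableWithinAt ?_
    exact ((((differentiableAt_const _).div differentiableAt_id hz0).cpow
      (differentiableAt_const _) hz1)).mul (differentiableAt_const _)
  refine h1.eqOn_of_preconnected_of_frequently_eq h2 isPreconnected_re_pos (z₀ := 1)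
    (by simp) ?_ hr
  have ht : Tendsto (fun x : ℝ => (x : ℂ)) (𝓝[≠] 1) (𝓝[≠] 1) := by
    refine tendsto_nhdsWithin_iff.2 ⟨?_, ?_⟩
    · exact (Complex.continuous_ofReal.tendsto' 1 1 (by simp)).mono_left nhdsWithin_le_nhds
    · filter_upwards [self_mem_nhdsWithin] with x hx
      simpa using hx
  refine ht.frequently (Eventually.frequently ?_)
  filter_upwards [nhdsWithin_le_nhds (lt_mem_nhds (one_pos : (0 : ℝ) < 1))] with x hx
  exact Complex.integral_cpow_mul_exp_neg_mul_Ioi hs hx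

/-! ### The frequencies and the Fourier coefficients -/

/-- The number `log 2 - 2πiy`. -/
noncomputable def freq (y : ℝ) : ℂ := (Real.log 2 : ℂ) - 2 * (Real.pi : ℂ) * Complex.I * (y : ℂ)

theorem freq_re (y : ℝ) : (freq y).re = Real.log 2 := by
  rw [freq, Complex.sub_re, Complex.ofReal_re]
  simp

theorem freq_im (y : ℝ) : (freq y).im = -(2 * Real.pi * y) := by
  rw [freq, Complex.sub_im, Complex.ofReal_im]
  simp

theorem freq_re_pos (y : ℝ) : 0 < (freq y).re := by
  rw [freq_re]; exact Real.log_pos one_lt_two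

theorem freq_ne_zero (y : ℝ) : freq y ≠ 0 := fun h => by
  have := freq_re_pos y
  rw [h] at this
  simp at this

theorem abs_le_norm_freq (y : ℝ) : |y| ≤ ‖freq y‖ := by
  have h := Complex.abs_im_le_norm (freq y)
  rw [freq_im, abs_neg, abs_mul, abs_of_pos (by positivity)] at h
  have := Real.pi_gt_three
  nlinarith [abs_nonneg y]

theorem half_le_norm_freq (y : ℝ) : 1 / 2 ≤ ‖freq y‖ := by
  have h := Complex.abs_re_le_norm (freq y)
  rw [freq_re, abs_of_pos (Real.log_pos one_lt_two)] at h
  linarith [Real.log_two_gt_d9]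

theorem zetaTerm_eq (s : ℂ) (n : ℤ) : zetaTerm s n = c n / freq n ^ s := by
  simp [zetaTerm, freq]

theorem norm_inv_freq_cpow_le (y : ℝ) (s : ℂ) :
    ‖(freq y ^ s)⁻¹‖ ≤ ‖freq y‖ ^ (-s.re) * Real.exp (Real.pi * |s.im|) := by
  rw [norm_inv, Complex.norm_cpow_of_ne_zero (freq_ne_zero y), inv_div, div_eq_mul_inv,
    Real.rpow_neg (norm_nonneg _), mul_comm]
  refine mul_le_mul_of_nonneg_left (Real.exp_le_exp.2 ?_) (by positivity)
  calc _ ≤ |(freq y).arg * s.im| := le_abs_self _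
    _ = |(freq y).arg| * |s.im| := abs_mul _ _
    _ ≤ _ := by gcongr; exact Complex.abs_arg_le_pi _

theorem exp_freq_mul (y x : ℝ) : Complex.exp (freq y * x) =
    Complex.exp (-(2 * Real.pi * Complex.I * y * x)) * ((2 : ℝ) ^ x : ℝ) := by
  rw [Real.rpow_def_of_pos two_pos, Complex.ofReal_exp, ← Complex.exp_add, freq]
  congr 1
  push_cast
  ring

theorem c_eq_intervalIntegral (n : ℤ) :
    c n = ∫ x in (0 : ℝ)..1, Complex.exp (-(2 * Real.pi * Complex.I * n * x)) * Psi x := by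
  rw [c, fourierCoeffOn_eq_integral]
  simp only [sub_zero, div_one, one_smul]
  refine intervalIntegral.integral_congr fun x _ => ?_
  simp only [fourier_coe_apply, smul_eq_mul]
  congr 2
  push_cast
  ring

/-- The factor `2^y` of `Ψ` is absorbed into the exponential, so that `c n` becomes an integral
against `tail` and can be integrated by parts. -/
theorem indicator_exp_freq_mul_tail (n : ℤ) :
    (fun y : ℝ => (Ioc (0 : ℝ) 1).indicator (fun y : ℝ => Complex.exp (freq n * y)) y * tail y) =
    (Ioc (0 : ℝ) 1).indicator
      fun y : ℝ => Complex.exp (-(2 * Real.pi * Complex.I * n * y)) * Psi y := by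
  ext y
  by_cases hy : y ∈ Ioc (0 : ℝ) 1
  · rw [indicator_of_mem hy, indicator_of_mem hy, exp_freq_mul, Psi, tail]
    push_cast
    ring
  · rw [indicator_of_notMem hy, indicator_of_notMem hy, zero_mul]

theorem measurable_Psi : Measurable Psi := by
  unfold Psi
  exact (by fun_prop : Measurable fun x : ℝ => (2 : ℝ) ^ x).mul
    (measurable_const.sub monotone_F.measurable)

theorem Psi_nonneg (x : ℝ) : 0 ≤ Psi x := mul_nonneg (by positivity) (tail_pos x).le

theorem norm_Psi_le (x : ℝ) : ‖(Psi x : ℂ)‖ ≤ 2 := by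
  rw [Complex.norm_real, Real.norm_of_nonneg (Psi_nonneg x)]
  have := tail_le x
  rw [tail_eq_Psi, mul_comm 2] at this
  exact le_of_mul_le_mul_left this (by positivity)

theorem norm_exp_neg_two_pi_I (y x : ℝ) :
    ‖Complex.exp (-(2 * Real.pi * Complex.I * y * x))‖ = 1 := by
  rw [Complex.norm_exp]; simp

theorem integrableOn_exp_mul_Psi (n : ℤ) :
    IntegrableOn (fun y : ℝ => Complex.exp (-(2 * Real.pi * Complex.I * n * y)) * Psi y)
      (Ioc 0 1) := by
  refine Integrable.mono' (g := fun _ => 2) (integrable_const _) ?_ (Eventually.of_forall fun x => ?_)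
  · exact ((by fun_prop : Measurable fun y : ℝ =>
      Complex.exp (-(2 * Real.pi * Complex.I * n * y))).mul
      (Complex.measurable_ofReal.comp measurable_Psi)).aestronglyMeasurable
  · rw [norm_mul]
    have := norm_exp_neg_two_pi_I n x
    rw [Complex.ofReal_intCast] at this
    rw [this, one_mul]
    exact norm_Psi_le x

theorem norm_primitive_exp_freq_le (n : ℤ) {x : ℝ} (hx : 0 ≤ x) :
    ‖∫ y in Ioi 0, (Iio x).indicator
      ((Ioc (0 : ℝ) 1).indicator fun y : ℝ => Complex.exp (freq n * y)) y‖ ≤ 3 / ‖freq n‖ := by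
  have e : ∫ y in Ioi 0, (Iio x).indicator
      ((Ioc (0 : ℝ) 1).indicator fun y : ℝ => Complex.exp (freq n * y)) y =
      ∫ y in (0 : ℝ)..(min x 1), Complex.exp (freq n * y) := by
    rw [intervalIntegral.integral_of_le (le_min hx zero_le_one), indicator_indicator,
      setIntegral_indicator (measurableSet_Iio.inter measurableSet_Ioc)]
    refine setIntegral_congr_set ?_
    have h1 : Ioi (0 : ℝ) ∩ (Iio x ∩ Ioc 0 1) = Iio x ∩ Ioc 0 1 := by
      ext y; simp; tauto
    have h2 : Ioc (0 : ℝ) (min x 1) = Iic x ∩ Ioc 0 1 := by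
      ext y; simp; tauto
    rw [h1, h2]
    exact Iio_ae_eq_Iic.inter (ae_eq_refl _)
  rw [e, integral_exp_mul_complex (freq_ne_zero n), norm_div]
  gcongr
  refine (norm_sub_le _ _).trans ?_
  -- The constant `3` is `2 + 1`, from the upper and lower endpoints.
  have h1 : ‖Complex.exp (freq n * ((min x 1 : ℝ) : ℂ))‖ ≤ 2 := by
    rw [Complex.norm_exp, Complex.re_mul_ofReal, freq_re, ← Real.rpow_def_of_pos two_pos]
    calc (2 : ℝ) ^ (min x 1) ≤ 2 ^ (1 : ℝ) :=
          Real.rpow_le_rpow_of_exponent_le one_le_two (min_le_right _ _)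
      _ = 2 := Real.rpow_one 2
  have h2 : ‖Complex.exp (freq n * ((0 : ℝ) : ℂ))‖ = 1 := by simp
  rw [h2]
  linarith

/-- The Fourier coefficients of `Ψ`, a function of bounded variation, are `O(1/n)`. -/
theorem exists_norm_c_le : ∃ C : ℝ, 0 ≤ C ∧ ∀ n : ℤ, ‖c n‖ ≤ C / ‖freq n‖ := by
  refine ⟨3 * dF.real univ, by positivity, fun n => ?_⟩
  have hm : Measurable ((Ioc (0 : ℝ) 1).indicator fun y : ℝ => Complex.exp (freq n * y)) :=
    (by fun_prop : Measurable fun y : ℝ => Complex.exp (freq n * y)).indicator measurableSet_Ioc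
  have hsub : Ioi (0 : ℝ) ∩ Ioc 0 1 = Ioc 0 1 := inter_eq_right.2 Ioc_subset_Ioi_self
  have hi : IntegrableOn (fun y : ℝ =>
      (Ioc (0 : ℝ) 1).indicator (fun y : ℝ => Complex.exp (freq n * y)) y * tail y) (Ioi 0) := by
    rw [indicator_exp_freq_mul_tail]
    exact ((integrable_indicator_iff measurableSet_Ioc).2 (integrableOn_exp_mul_Psi n)).integrableOn
  obtain ⟨-, h2⟩ := integral_primitive_dF hm hi
  rw [indicator_exp_freq_mul_tail, setIntegral_indicator measurableSet_Ioc, hsub,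
    ← intervalIntegral.integral_of_le zero_le_one, ← c_eq_intervalIntegral] at h2
  rw [← h2]
  refine (norm_integral_le_of_norm_le_const (C := 3 / ‖freq n‖) ?_).trans (le_of_eq (by ring))
  filter_upwards [dF_nonneg_ae] with x hx using norm_primitive_exp_freq_le n hx

/-! ### Convergence and holomorphy of the dyadic zeta series -/

theorem summable_norm_freq_rpow {b : ℝ} (hb : 1 < b) : Summable fun n : ℤ => ‖freq n‖ ^ (-b) := by
  refine Summable.of_norm_bounded_eventually (Real.summable_abs_int_rpow hb) ?_
  filter_upwards [(finite_singleton (0 : ℤ)).compl_mem_cofinite] with n hn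
  have hn : n ≠ 0 := by simpa using hn
  have h0 : 0 < |(n : ℝ)| := abs_pos.2 (by exact_mod_cast hn)
  rw [Real.norm_of_nonneg (by positivity)]
  exact Real.rpow_le_rpow_of_nonpos h0 (abs_le_norm_freq n) (by linarith)

/-- The decay of `c n` gains one power of the frequency, which moves absolute convergence from `Re s
> 1` to `Re s > 0`. -/
theorem exists_norm_zetaTerm_le : ∃ C : ℝ, 0 ≤ C ∧ ∀ (s : ℂ) (n : ℤ),
    ‖zetaTerm s n‖ ≤ C * ‖freq n‖ ^ (-(1 + s.re)) * Real.exp (Real.pi * |s.im|) := by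
  obtain ⟨C, hC, h⟩ := exists_norm_c_le
  refine ⟨C, hC, fun s n => ?_⟩
  have hf : 0 < ‖freq n‖ := norm_pos_iff.2 (freq_ne_zero n)
  rw [zetaTerm_eq, div_eq_mul_inv, norm_mul]
  refine (mul_le_mul (h n) (norm_inv_freq_cpow_le n s) (norm_nonneg _) (by positivity)).trans ?_
  rw [neg_add, Real.rpow_add hf, Real.rpow_neg_one]
  exact le_of_eq (by ring)

theorem summable_zetaTerm {s : ℂ} (hs : 0 < s.re) : Summable (zetaTerm s) := by
  obtain ⟨C, -, h⟩ := exists_norm_zetaTerm_le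
  refine Summable.of_norm_bounded ?_ (h s)
  exact ((summable_norm_freq_rpow (by linarith)).mul_left C).mul_right _

theorem differentiableOn_dyadicZeta : DifferentiableOn ℂ dyadicZeta {s : ℂ | 0 < s.re} := by
  obtain ⟨C, hC, h⟩ := exists_norm_zetaTerm_le
  intro s₀ hs₀
  have hs₀ : 0 < s₀.re := hs₀
  set δ := s₀.re / 2 with hδ
  set R := ‖s₀‖ + 1 with hR
  set U : Set ℂ := {s : ℂ | δ < s.re} ∩ Metric.ball 0 R with hU
  have hUo : IsOpen U :=
    (isOpen_lt continuous_const Complex.continuous_re).inter Metric.isOpen_ball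
  have hmem : s₀ ∈ U := ⟨by show δ < s₀.re; linarith, by simp [hR]⟩
  have hd : DifferentiableOn ℂ (fun s => ∑' n : ℤ, zetaTerm s n) U := by
    refine Complex.differentiableOn_tsum_of_summable_norm
      (u := fun n : ℤ => C * 2 ^ R * Real.exp (Real.pi * R) * ‖freq n‖ ^ (-(1 + δ)))
      ((summable_norm_freq_rpow (by linarith)).mul_left _) (fun n => ?_) hUo fun n s hs => ?_
    · simp only [zetaTerm_eq]
      intro s _
      refine DifferentiableAt.differentiableWithinAt ?_
      exact (differentiableAt_const _).div
        ((differentiableAt_id).const_cpow (Or.inl (freq_ne_zero n)))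
        (by simp [Complex.cpow_eq_zero_iff, freq_ne_zero n])
    · have hf : 0 < ‖freq n‖ := norm_pos_iff.2 (freq_ne_zero n)
      have h1 : δ < s.re := hs.1
      have h2 : ‖s‖ < R := by simpa using hs.2
      have h3 : |s.im| ≤ R := (Complex.abs_im_le_norm s).trans h2.le
      have h4 : s.re ≤ R := (Complex.re_le_norm s).trans h2.le
      -- The frequency at `n = 0` is `log 2 < 1`, so lowering the exponent costs a constant; the
      -- lower bound `1/2` makes it `2 ^ R`.
      have h5 : ‖freq n‖ ^ (-(1 + s.re)) ≤ 2 ^ R * ‖freq n‖ ^ (-(1 + δ)) := by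
        have e : -(1 + s.re) = -(s.re - δ) + -(1 + δ) := by ring
        rw [e, Real.rpow_add hf]
        gcongr
        calc ‖freq n‖ ^ (-(s.re - δ)) ≤ (1 / 2) ^ (-(s.re - δ)) :=
              Real.rpow_le_rpow_of_nonpos (by norm_num) (half_le_norm_freq n) (by linarith)
          _ = 2 ^ (s.re - δ) := by
              rw [one_div, Real.inv_rpow two_pos.le, Real.rpow_neg two_pos.le, inv_inv]
          _ ≤ 2 ^ R := Real.rpow_le_rpow_of_exponent_le one_le_two (by linarith)
      calc ‖zetaTerm s n‖ ≤ _ := h s n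
        _ ≤ C * (2 ^ R * ‖freq n‖ ^ (-(1 + δ))) * Real.exp (Real.pi * R) := by gcongr
        _ = _ := by ring
  exact (hd.differentiableAt (hUo.mem_nhds hmem)).differentiableWithinAt

end Minkowski

namespace Minkowski

open MeasureTheory Set Filter Topology

/-! ### The dyadic zeta function as a Mellin transform -/

/-- The function equal to `x^(s-1) 2^(-x)` for `x > 0`, extended by zero. -/
noncomputable def powExp (s : ℂ) (x : ℝ) : ℂ :=
  ((max x 0 : ℝ) : ℂ) ^ (s - 1) * Complex.exp (-(Real.log 2 * x))

/-- `Re s > 1` makes the power tend to `0` at the origin, so the extension by zero is continuous, as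
Poisson summation requires. -/
theorem continuous_powExp {s : ℂ} (hs : 1 < s.re) : Continuous (powExp s) := by
  have h := Complex.continuous_ofReal_cpow_const (y := s - 1) (by simpa using hs)
  have h' : Continuous fun x : ℝ => ((max x 0 : ℝ) : ℂ) ^ (s - 1) :=
    h.comp (continuous_id.max continuous_const)
  unfold powExp
  fun_prop

theorem powExp_of_nonpos {s : ℂ} (hs : 1 < s.re) {x : ℝ} (hx : x ≤ 0) : powExp s x = 0 := by
  have : s - 1 ≠ 0 := fun h => by
    have := congrArg Complex.re h
    simp at this
    linarith
  rw [powExp, max_eq_right hx, Complex.ofReal_zero, Complex.zero_cpow this, zero_mul]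

theorem powExp_of_pos (s : ℂ) {x : ℝ} (hx : 0 < x) :
    powExp s x = (x : ℂ) ^ (s - 1) * Complex.exp (-(Real.log 2 * x)) := by
  rw [powExp, max_eq_left hx.le]

/-- The Fourier transform at `ξ` is the Laplace transform of `x^(s-1)` at `log 2 + 2πiξ`. -/
theorem fourier_powExp {s : ℂ} (hs : 1 < s.re) (ξ : ℝ) :
    FourierTransform.fourier (powExp s) ξ = (freq (-ξ) ^ s)⁻¹ * Complex.Gamma s := by
  have harg : (freq (-ξ)).arg ≠ Real.pi :=
    Complex.slitPlane_arg_ne_pi (Or.inl (freq_re_pos (-ξ)))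
  rw [Real.fourier_real_eq_integral_exp_smul, ← Complex.inv_cpow _ _ harg, ← one_div,
    ← laplace_cpow (by linarith) (freq_re_pos (-ξ)), ← integral_indicator measurableSet_Ioi]
  congr 1 with x
  by_cases hx : 0 < x
  · rw [indicator_of_mem (show x ∈ Ioi (0 : ℝ) from hx), powExp_of_pos s hx, smul_eq_mul,
      mul_left_comm, ← Complex.exp_add, freq]
    congr 2
    push_cast
    ring
  · rw [indicator_of_notMem (show x ∉ Ioi (0 : ℝ) from hx), powExp_of_nonpos hs (not_lt.1 hx),
      smul_zero]

theorem powExp_isBigO {s : ℂ} (hs : 1 < s.re) :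
    powExp s =O[cocompact ℝ] fun x : ℝ => |x| ^ (-s.re) := by
  rw [cocompact_eq_atBot_atTop, Asymptotics.isBigO_sup]
  constructor
  · refine Asymptotics.IsBigO.of_bound 1 ?_
    filter_upwards [eventually_le_atBot 0] with x hx
    rw [powExp_of_nonpos hs hx, norm_zero]
    positivity
  -- The exponent is chosen so that multiplying by `x^(Re s - 1)` leaves `x^(-Re s)`.
  · have h := (isLittleO_exp_neg_mul_rpow_atTop (Real.log_pos one_lt_two)
      (-s.re - (s.re - 1))).isBigO
    have h2 := (Asymptotics.isBigO_refl (fun x : ℝ => x ^ (s.re - 1)) atTop).mul h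
    refine Asymptotics.IsBigO.trans (Asymptotics.IsBigO.of_bound 1 ?_)
      (h2.congr' EventuallyEq.rfl ?_)
    · filter_upwards [eventually_gt_atTop 0] with x hx
      rw [powExp_of_pos s hx, norm_cpow_mul_exp hx, one_mul, Complex.ofReal_re]
      exact le_abs_self _
    · filter_upwards [eventually_gt_atTop 0] with x hx
      rw [← Real.rpow_add hx, abs_of_pos hx]
      congr 1
      ring

theorem norm_fourier_powExp_le {s : ℂ} (hs : 1 < s.re) (ξ : ℝ) :
    ‖FourierTransform.fourier (powExp s) ξ‖ ≤
      Real.exp (Real.pi * |s.im|) * ‖Complex.Gamma s‖ * ‖freq (-ξ)‖ ^ (-s.re) := by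
  rw [fourier_powExp hs, norm_mul]
  calc _ ≤ _ := mul_le_mul_of_nonneg_right (norm_inv_freq_cpow_le (-ξ) s) (norm_nonneg _)
    _ = _ := by ring

theorem fourier_powExp_isBigO {s : ℂ} (hs : 1 < s.re) :
    FourierTransform.fourier (powExp s) =O[cocompact ℝ] fun x : ℝ => |x| ^ (-s.re) := by
  refine Asymptotics.IsBigO.of_bound (Real.exp (Real.pi * |s.im|) * ‖Complex.Gamma s‖) ?_
  filter_upwards [(isCompact_singleton (x := (0 : ℝ))).compl_mem_cocompact] with ξ hξ
  have hξ : 0 < |ξ| := abs_pos.2 hξ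
  refine (norm_fourier_powExp_le hs ξ).trans ?_
  rw [Real.norm_of_nonneg (by positivity)]
  have := abs_le_norm_freq (-ξ)
  rw [abs_neg] at this
  exact mul_le_mul_of_nonneg_left (Real.rpow_le_rpow_of_nonpos hξ this (by linarith))
    (by positivity)

theorem Psi_add_int (x : ℝ) (n : ℤ) : Psi (x + n) = Psi x := by
  have h : Function.Periodic Psi 1 := Psi_add_one
  simpa using h.int_mul n x

theorem Psi_mul_powExp {s : ℂ} (hs : 1 < s.re) :
    (fun x => (Psi x : ℂ) * powExp s x) =
      (Ioi 0).indicator fun x : ℝ => (x : ℂ) ^ (s - 1) * (tail x : ℂ) := by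
  ext x
  by_cases hx : 0 < x
  · rw [indicator_of_mem (show x ∈ Ioi (0 : ℝ) from hx), powExp_of_pos s hx, tail_eq_Psi,
      Real.rpow_def_of_pos two_pos]
    push_cast
    ring_nf
  · rw [indicator_of_notMem (show x ∉ Ioi (0 : ℝ) from hx), powExp_of_nonpos hs (not_lt.1 hx),
      mul_zero]

/-- The Mellin integral is folded onto `(0, 1]` using the period of `Ψ`. Poisson summation is
applied to `powExp`, not a Fourier expansion to `Ψ`, so pointwise convergence of the Fourier series
of `Ψ` plays no role. -/
theorem Gamma_mul_dyadicZeta_of_one_lt_re {s : ℂ} (hs : 1 < s.re) :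
    Complex.Gamma s * dyadicZeta s = mellin (fun x => (tail x : ℂ)) s := by
  set G : ℝ → ℂ := fun x => (Psi x : ℂ) * powExp s x with hG
  have hGi : Integrable G := by
    rw [hG, Psi_mul_powExp hs]
    exact (integrable_indicator_iff measurableSet_Ioi).2 (mellinConvergent_tail (by linarith))
  have hGe : ∫ x, G x = mellin (fun x => (tail x : ℂ)) s := by
    rw [hG, Psi_mul_powExp hs, integral_indicator measurableSet_Ioi]
    rfl
  have hGn : ∀ (x : ℝ) (n : ℤ), G (x + n) = Psi x * powExp s (x + n) := fun x n => by
    simp only [hG, Psi_add_int]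
  have hsum1 := hGi.hasSum_intervalIntegral_comp_add_int
  have hsum2 := hGi.norm.hasSum_intervalIntegral_comp_add_int
  simp only [intervalIntegral.integral_of_le zero_le_one] at hsum1 hsum2
  have swap1 := integral_tsum_of_summable_integral_norm
    (μ := volume.restrict (Ioc (0 : ℝ) 1)) (F := fun (n : ℤ) x => G (x + n))
    (fun n => (hGi.comp_add_right (n : ℝ)).integrableOn) hsum2.summable
  rw [hsum1.tsum_eq, hGe] at swap1
  have poisson : ∀ x : ℝ, ∑' n : ℤ, G (x + n) =
      ∑' n : ℤ, FourierTransform.fourier (powExp s) n *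
        (Complex.exp (-(2 * Real.pi * Complex.I * (-n : ℤ) * x)) * Psi x) := fun x => by
    simp only [hGn]
    rw [tsum_mul_left, Real.tsum_eq_tsum_fourier_of_rpow_decay (continuous_powExp hs) hs
      (powExp_isBigO hs) (fourier_powExp_isBigO hs), ← tsum_mul_left]
    refine tsum_congr fun n => ?_
    rw [fourier_coe_apply, mul_comm, mul_assoc]
    congr 3
    push_cast
    ring
  -- Termwise integration: the `L¹` norms are bounded by a constant times `‖freq (-n)‖ ^ (-Re s)`,
  -- summable because `Re s > 1`.
  have swap2 := integral_tsum_of_summable_integral_norm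
    (μ := volume.restrict (Ioc (0 : ℝ) 1)) (F := fun (n : ℤ) (x : ℝ) =>
      FourierTransform.fourier (powExp s) n *
        (Complex.exp (-(2 * Real.pi * Complex.I * (-n : ℤ) * x)) * Psi x))
    (fun n => (integrableOn_exp_mul_Psi (-n)).const_mul _) (by
      have hS : Summable fun n : ℤ => ‖freq (-(n : ℝ))‖ ^ (-s.re) := by
        have := (Equiv.neg ℤ).summable_iff.2 (summable_norm_freq_rpow hs)
        refine this.congr fun n => ?_
        simp
      refine Summable.of_norm_bounded
        ((hS.mul_left (Real.exp (Real.pi * |s.im|) * ‖Complex.Gamma s‖)).mul_right 2) fun n => ?_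
      rw [Real.norm_of_nonneg (integral_nonneg fun x => norm_nonneg _)]
      refine (integral_mono_of_nonneg (Eventually.of_forall fun x => norm_nonneg _)
        (integrable_const _) (Eventually.of_forall fun x => ?_)).trans (le_of_eq (integral_const _))
        |>.trans (le_of_eq (by simp; rfl))
      have := norm_exp_neg_two_pi_I ((-n : ℤ) : ℝ) x
      rw [Complex.ofReal_intCast] at this
      show ‖_ * _‖ ≤ _
      rw [norm_mul, norm_mul, this, one_mul]
      exact mul_le_mul (norm_fourier_powExp_le hs n) (norm_Psi_le x) (norm_nonneg _)
        (by positivity))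
  simp only [poisson] at swap1
  rw [swap1, ← swap2, dyadicZeta, ← tsum_mul_left,
    ← (Equiv.neg ℤ).tsum_eq fun n => Complex.Gamma s * zetaTerm s n]
  refine tsum_congr fun n => ?_
  rw [integral_const_mul, ← intervalIntegral.integral_of_le zero_le_one, ← c_eq_intervalIntegral,
    fourier_powExp hs, Equiv.neg_apply, zetaTerm_eq]
  push_cast
  rw [div_eq_mul_inv]
  ring

end Minkowski

namespace Minkowski

open MeasureTheory Set Filter Topology

/-! ### The entire extension -/

/-- The entire extension of the dyadic zeta function. -/
noncomputable def zetaExt (s : ℂ) : ℂ := complexMoment s * (Complex.Gamma (s + 1))⁻¹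

theorem differentiable_zetaExt : Differentiable ℂ zetaExt :=
  differentiable_complexMoment.mul
    (Complex.differentiable_one_div_Gamma.comp (differentiable_id.add_const 1))

theorem zetaExt_of_one_lt_re {s : ℂ} (hs : 1 < s.re) : zetaExt s = dyadicZeta s := by
  have h0 : 0 < s.re := by linarith
  have hs0 : s ≠ 0 := by rintro rfl; simp at h0
  have hG := Complex.Gamma_ne_zero_of_re_pos h0
  rw [zetaExt, complexMoment_eq_mellin h0, ← Gamma_mul_dyadicZeta_of_one_lt_re hs,
    Complex.Gamma_add_one s hs0]
  field_simp

/-- Poisson summation gives equality near `2`; analyticity of the series propagates it to the half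
plane. -/
theorem zetaExt_of_re_pos {s : ℂ} (hs : 0 < s.re) : zetaExt s = dyadicZeta s := by
  have h1 : AnalyticOnNhd ℂ zetaExt {s : ℂ | 0 < s.re} :=
    differentiable_zetaExt.differentiableOn.analyticOnNhd isOpen_re_pos
  have h2 := differentiableOn_dyadicZeta.analyticOnNhd isOpen_re_pos
  refine h1.eqOn_of_preconnected_of_eventuallyEq h2 isPreconnected_re_pos (z₀ := 2) (by simp) ?_ hs
  filter_upwards [(isOpen_lt continuous_const Complex.continuous_re).mem_nhds
    (show (1 : ℝ) < (2 : ℂ).re by norm_num)] with z hz using zetaExt_of_one_lt_re hz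

/-- By `Γ(s+1) = s Γ(s)` the product is an even function over `s`, hence odd. -/
theorem zetaExt_mul_Gamma {s : ℂ} (hs : ∀ k : ℤ, s ≠ k) :
    zetaExt s * Complex.Gamma s = complexMoment s / s := by
  have hs0 : s ≠ 0 := by simpa using hs 0
  have hG : Complex.Gamma s ≠ 0 := Complex.Gamma_ne_zero fun m => by simpa using hs (-m)
  rw [zetaExt, Complex.Gamma_add_one s hs0]
  field_simp

theorem zetaExt_functional_equation {s : ℂ} (hs : ∀ k : ℤ, s ≠ k) :
    zetaExt s * Complex.Gamma s = -(zetaExt (-s) * Complex.Gamma (-s)) := by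
  rw [zetaExt_mul_Gamma hs, zetaExt_mul_Gamma fun k hk => hs (-k) (by
    push_cast; rw [← hk, neg_neg]), complexMoment_neg, div_neg, neg_neg]

theorem zetaExt_natCast {L : ℕ} (hL : 1 ≤ L) : zetaExt L = moment L / L.factorial := by
  rw [zetaExt, (complexMoment_natCast hL).2, Complex.Gamma_nat_eq_factorial, div_eq_mul_inv]

theorem inv_Gamma_neg_natCast (m : ℕ) : (Complex.Gamma (-m))⁻¹ = 0 := by
  rw [Complex.Gamma_neg_nat_eq_zero, inv_zero]

/-- Differentiating `1/Γ(z) = z/Γ(z+1)` at `z = -(m+1)`, where `1/Γ(z+1)` vanishes, multiplies the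
previous derivative by `-(m+1)`. -/
theorem hasDerivAt_inv_Gamma_neg_natCast (m : ℕ) :
    HasDerivAt (fun s => (Complex.Gamma s)⁻¹) ((m.factorial : ℂ) * (-1) ^ m) (-m) := by
  have step : ∀ (z d : ℂ), HasDerivAt (fun s => (Complex.Gamma s)⁻¹) d (z + 1) →
      HasDerivAt (fun s => (Complex.Gamma s)⁻¹) ((Complex.Gamma (z + 1))⁻¹ + z * d) z := by
    intro z d h
    have h2 := (hasDerivAt_id z).mul (h.comp_add_const z 1)
    have e : (fun s => (Complex.Gamma s)⁻¹) = id * fun s => (Complex.Gamma (s + 1))⁻¹ := by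
      ext s
      exact Complex.one_div_Gamma_eq_self_mul_one_div_Gamma_add_one s
    rw [e]
    simpa using h2
  induction m with
  | zero =>
    have := step 0 _ (Complex.differentiable_one_div_Gamma _).hasDerivAt
    simpa using this
  | succ m ih =>
    have e : -((m + 1 : ℕ) : ℂ) + 1 = -m := by push_cast; ring
    have := step (-((m + 1 : ℕ) : ℂ)) _ (by rw [e]; exact ih)
    rw [e, inv_Gamma_neg_natCast, zero_add] at this
    convert this using 1
    rw [Nat.factorial_succ]
    push_cast
    ring

/-- The zero is that of `1/Γ` at `-L + 1 = -(L-1)`, whence the factorial of `L - 1`; only the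
derivative of `1/Γ` survives in the product rule, and evenness turns the other factor into `M_L`. -/
theorem zetaExt_neg_natCast {L : ℕ} (hL : 1 ≤ L) :
    zetaExt (-L) = 0 ∧
      deriv zetaExt (-L) = ((L - 1).factorial : ℂ) * (-1) ^ (L - 1) * (moment L : ℂ) := by
  obtain ⟨m, rfl⟩ : ∃ m, L = m + 1 := ⟨L - 1, by omega⟩
  have e : -((m + 1 : ℕ) : ℂ) + 1 = -m := by push_cast; ring
  constructor
  · rw [zetaExt, e, inv_Gamma_neg_natCast, mul_zero]
  · have h1 : HasDerivAt (fun s => (Complex.Gamma (s + 1))⁻¹) ((m.factorial : ℂ) * (-1) ^ m)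
        (-((m + 1 : ℕ) : ℂ)) :=
      HasDerivAt.comp_add_const (-((m + 1 : ℕ) : ℂ)) 1 (by rw [e]; exact hasDerivAt_inv_Gamma_neg_natCast m)
    have h2 := (differentiable_complexMoment (-((m + 1 : ℕ) : ℂ))).hasDerivAt.mul h1
    rw [e, inv_Gamma_neg_natCast, mul_zero, zero_add, complexMoment_neg,
      (complexMoment_natCast hL).2] at h2
    rw [show zetaExt = complexMoment * fun s => (Complex.Gamma (s + 1))⁻¹ from rfl, h2.deriv]
    simp only [Nat.add_sub_cancel]
    ring

theorem zetaExt_conj (s : ℂ) : zetaExt (starRingEnd ℂ s) = starRingEnd ℂ (zetaExt s) := by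
  have e : starRingEnd ℂ s + 1 = starRingEnd ℂ (s + 1) := by simp
  rw [zetaExt, zetaExt, complexMoment_conj, e, Complex.Gamma_conj, map_mul, map_inv₀]

theorem zetaExt_ofReal_im (x : ℝ) : (zetaExt x).im = 0 := by
  rw [← Complex.conj_eq_iff_im, ← zetaExt_conj, Complex.conj_ofReal]

theorem exists_norm_zetaExt_le (a b : ℝ) : ∃ C : ℝ, ∀ σ t : ℝ, a ≤ σ → σ ≤ b → 1 ≤ |t| →
    ‖zetaExt (σ + t * Complex.I)‖ ≤
      C * |t| ^ (-σ - 1 / 2) * Real.exp (Real.pi * |t| / 2) := by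
  obtain ⟨C₁, hC₁, h1⟩ := exists_norm_complexMoment_le a b
  obtain ⟨C₂, -, h2⟩ := exists_norm_inv_Gamma_le a b
  refine ⟨C₁ * C₂, fun σ t ha hb ht => ?_⟩
  rw [zetaExt, norm_mul]
  have := mul_le_mul (h1 (σ + t * Complex.I) (by simpa using ha) (by simpa using hb))
    (h2 σ t ha hb ht) (norm_nonneg _) hC₁
  exact this.trans (le_of_eq (by ring))

end Minkowski
theorem theorem6 :
    -- the series converges absolutely in the half plane `Re s > 0`, where it defines the function
    (∀ s : ℂ, 0 < s.re → Summable (Minkowski.zetaTerm s)) ∧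
    -- it has an entire extension `Z` with all of the following properties
    ∃ Z : ℂ → ℂ,
      Differentiable ℂ Z ∧
      (∀ s : ℂ, 0 < s.re → Z s = Minkowski.dyadicZeta s) ∧
      -- functional equation (of meromorphic functions, whose poles can only be integers)
      (∀ s : ℂ, (∀ k : ℤ, s ≠ (k : ℂ)) →
        Z s * Complex.Gamma s = -(Z (-s) * Complex.Gamma (-s))) ∧
      -- special values at the positive integers (the moments being finite)
      (∀ L : ℕ, 1 ≤ L →
        MeasureTheory.Integrable (fun x : ℝ => x ^ L) Minkowski.dF ∧
        Z (L : ℂ) = (Minkowski.moment L : ℂ) / (L.factorial : ℂ)) ∧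
      -- trivial zeros, and the derivative there
      (∀ L : ℕ, 1 ≤ L →
        Z (-(L : ℂ)) = 0 ∧
        deriv Z (-(L : ℂ)) =
          ((L - 1).factorial : ℂ) * (-1) ^ (L - 1) * (Minkowski.moment L : ℂ)) ∧
      -- reality on the real line, and the resulting reflection symmetry
      (∀ x : ℝ, (Z (x : ℂ)).im = 0) ∧
      (∀ s : ℂ, Z (starRingEnd ℂ s) = starRingEnd ℂ (Z s)) ∧
      -- growth in vertical strips, uniformly in `a ≤ σ ≤ b`
      (∀ a b : ℝ, ∃ C T : ℝ, 0 < T ∧ ∀ σ t : ℝ, a ≤ σ → σ ≤ b → T ≤ |t| →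
        ‖Z ((σ : ℂ) + (t : ℂ) * Complex.I)‖ ≤
          C * |t| ^ (-σ - 1 / 2) * Real.exp (Real.pi * |t| / 2)) := by
  open Minkowski in
  exact ⟨fun s hs => summable_zetaTerm hs, zetaExt, differentiable_zetaExt,
    fun s hs => zetaExt_of_re_pos hs, fun s hs => zetaExt_functional_equation hs,
    fun L hL => ⟨(complexMoment_natCast hL).1, zetaExt_natCast hL⟩,
    fun L hL => zetaExt_neg_natCast hL, zetaExt_ofReal_im, zetaExt_conj, fun a b => by
      obtain ⟨C, hC⟩ := exists_norm_zetaExt_le a b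
      exact ⟨C, 1, one_pos, hC⟩⟩
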